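/- Let $H$ and $G_1,\dots,G_m$ ($m\ge 1$) be real Hilbert spaces, let $f:H\to\mathbb R$ be convex and differentiable with $L$-Lipschitz continuous gradient, $L\in(0,+\infty)$, let $g:H\to(-\infty,+\infty]$ and $h_i:G_i\to(-\infty,+\infty]$ be proper, lower semicontinuous and convex, and let $B_i:H\to G_i$ be bounded linear operators. Consider the problem $$\min_{x\in H}\ f(x)+g(x)+\sum_{i=1}^m h_i(B_i x),\qquad(1.1)$$ and assume that its optimality inclusion $0\in\nabla f(x)+\partial g(x)+\sum_{i=1}^m B_i^*\,\partial h_i(B_i x)$ has at least one solution $x\in H$. Write $\mathrm{prox}_{\lambda\varphi}(u)=\arg\min_z\{\tfrac12\|z-u\|^2+\lambda\varphi(z)\}$ and $\varphi^*(y)=\sup_x\{\langle x,y\rangle-\varphi(x)\}$. Let $w_1,\dots,w_m>0$ with $\sum_i w_i=1$, and let $\mathbf G=G_1\times\cdots\times G_m$ carry the scalar product $\langle \mathbf y,\mathbf z\rangle_{1,\mathbf G}=\sum_i w_i\langle y_i,z_i\rangle$. Let $\gamma\in(0,2/L)$ and $\sigma,\tau>0$ with $\sigma\tau\sum_i w_i\|B_i\|^2<1$.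 Starting from arbitrary $x^0\in H$ and $\mathbf y^0\in\mathbf G$, run the primal-dual forward-backward splitting algorithm (Algorithm 4.3) with exactly one inner iteration per outer iteration and with the inner variable $\bar x^k=x^k$ for all $k\ge0$; that is, for $k=0,1,2,\dots$, $$u^k=x^k-\gamma\nabla f(x^k),\qquad x^{k+1}=\mathrm{prox}_{\frac{\tau\gamma}{1+\tau}g}\Big(\frac{x^k-\tau\sum_{i=1}^m w_iB_i^*y_i^k+\tau u^k}{1+\tau}\Big),$$ $$y_i^{k+1}=\frac{\gamma}{w_i}\,\mathrm{prox}_{\frac{w_i\sigma}{\gamma}h_i^*}\Big(\frac{w_i}{\gamma}\big(y_i^k+\sigma B_i(2x^{k+1}-x^k)\big)\Big),\qquad i=1,\dots,m.$$ Then: (a) With $\mathbf h(\mathbf y)=\sum_i h_i(y_i)$, $\mathbf Bx=(B_1x,\dots,B_mx)$, $\tau'=\frac{\tau\gamma}{1+\tau}$, $\sigma'=\frac{\sigma}{\gamma}$ and $\bar{\mathbf y}^k=\frac1\gamma\mathbf y^k$, the sequences satisfy the Condat–Vũ iteration $$x^{k+1}=\mathrm{prox}_{\tau'g}\big(x^k-\tau'\nabla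 f(x^k)-\tau'\mathbf B^*\bar{\mathbf y}^k\big),\qquad \bar{\mathbf y}^{k+1}=\mathrm{prox}_{\sigma'\mathbf h^*}\big(\bar{\mathbf y}^k+\sigma'\mathbf B(2x^{k+1}-x^k)\big)\qquad(k\ge0),$$ where $\mathbf B^*$, $\mathbf h^*$ and $\mathrm{prox}_{\sigma'\mathbf h^*}$ are taken with respect to $\langle\cdot,\cdot\rangle_{1,\mathbf G}$. (b) The sequence $(x^k)$ converges weakly in $H$ to a solution of (1.1). -/

import Mathlib

open Filter Topology
open scoped Gradient

/-- The class `Γ₀(H)`: proper, lower semicontinuous, convex functions `H → (-∞, +∞]`.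
Convexity is convexity of the epigraph. -/
structure IsGammaZero {H : Type*} [NormedAddCommGroup H] [InnerProductSpace ℝ H]
    (φ : H → EReal) : Prop where
  ne_bot : ∀ x, φ x ≠ ⊥
  exists_ne_top : ∃ x, φ x ≠ ⊤
  lsc : LowerSemicontinuous φ
  convex_epigraph : Convex ℝ {p : H × ℝ | φ p.1 ≤ (p.2 : EReal)}

/-- `p = prox_{lam φ}(u)` in the space `E` with scalar product `ip`: the point `p` minimizes
`z ↦ (1/2) ‖z - u‖² + lam φ(z)`, where `‖v‖² = ip v v`. -/
def IsProx {E : Type*} [AddCommGroup E] (ip : E → E → ℝ) (lam : ℝ) (φ : E → EReal)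
    (u p : E) : Prop :=
  ∀ z : E, ((1 / 2 * ip (p - u) (p - u) : ℝ) : EReal) + (lam : EReal) * φ p ≤
    ((1 / 2 * ip (z - u) (z - u) : ℝ) : EReal) + (lam : EReal) * φ z

/-- The Fenchel conjugate `φ*(y) = sup_x (ip x y - φ x)` with respect to the scalar product `ip`. -/
noncomputable def fenchelConj {E : Type*} (ip : E → E → ℝ) (φ : E → EReal) (y : E) : EReal :=
  ⨆ x : E, ((ip x y : ℝ) : EReal) - φ x

/-- `v ∈ ∂φ(x)`. -/
def IsSubgradient {H : Type*} [NormedAddCommGroup H] [InnerProductSpace ℝ H]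
    (φ : H → EReal) (x v : H) : Prop :=
  ∀ z : H, φ x + ((inner ℝ v (z - x) : ℝ) : EReal) ≤ φ z

section Problem

variable {H : Type*} [NormedAddCommGroup H] [InnerProductSpace ℝ H] [CompleteSpace H]
variable {m : ℕ} {G : Fin m → Type*} [∀ i, NormedAddCommGroup (G i)]
  [∀ i, InnerProductSpace ℝ (G i)] [∀ i, CompleteSpace (G i)]

/-- The objective `f(x) + g(x) + ∑ i, h i (B i x)`. -/
noncomputable def objective (f : H → ℝ) (g : H → EReal) (h : ∀ i, G i → EReal)
    (B : ∀ i, H →L[ℝ] G i) (x : H) : EReal :=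
  (f x : EReal) + g x + ∑ i, h i (B i x)

/-- `x` is a solution of `min f + g + ∑ i, h i ∘ B i`. -/
def IsSolution (f : H → ℝ) (g : H → EReal) (h : ∀ i, G i → EReal)
    (B : ∀ i, H →L[ℝ] G i) (x : H) : Prop :=
  IsMinOn (objective f g h B) Set.univ x

/-- The optimality inclusion `0 ∈ ∇f(x) + ∂g(x) + ∑ i, (B i)* ∂(h i)(B i x)` is solvable. -/
def OptimalityInclusionSolvable (f : H → ℝ) (g : H → EReal) (h : ∀ i, G i → EReal)
    (B : ∀ i, H →L[ℝ] G i) : Prop :=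
  ∃ (x : H) (v : ∀ i, G i), (∀ i, IsSubgradient (h i) (B i x) (v i)) ∧
    IsSubgradient g x (-(∇ f x) - ∑ i, (B i).adjoint (v i))

/-- The weighted scalar product `⟨y, z⟩_{1,G} = ∑ i, w i ⟨y i, z i⟩` on `∏ i, G i`. -/
noncomputable def weightedInner (w : Fin m → ℝ) (y z : ∀ i, G i) : ℝ :=
  ∑ i, w i * inner ℝ (y i) (z i)

/-- The first primal-dual forward-backward splitting algorithm, with `J k` inner iterations in the
`k`-th outer iteration. `xbar k j` and `y k j` are the `j`-th inner iterates of outer iteration `k`;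
each inner loop starts where the previous one ended. -/
structure IsPrimalDualRun (f : H → ℝ) (g : H → EReal) (h : ∀ i, G i → EReal)
    (B : ∀ i, H →L[ℝ] G i) (w : Fin m → ℝ) (γ σ τ : ℝ) (J : ℕ → ℕ)
    (u x : ℕ → H) (xbar : ℕ → ℕ → H) (y : ℕ → ℕ → ∀ i, G i) : Prop where
  outer : ∀ k, u k = x k - γ • ∇ f (x k)
  inner_primal : ∀ k, ∀ j < J k,
    IsProx (fun a b : H => inner ℝ a b) (τ * γ / (1 + τ)) g
      ((1 / (1 + τ)) • (xbar k j - τ • ∑ i, w i • (B i).adjoint (y k j i) + τ • u k))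
      (xbar k (j + 1))
  inner_dual : ∀ k, ∀ j < J k, ∀ i, ∃ p : G i,
    IsProx (fun a b : G i => inner ℝ a b) (w i * (σ / γ))
      (fenchelConj (fun a b : G i => inner ℝ a b) (h i))
      ((w i / γ) • (y k j i + σ • B i ((2 : ℝ) • xbar k (j + 1) - xbar k j))) p ∧
    y k (j + 1) i = (γ / w i) • p
  update : ∀ k, x (k + 1) = xbar k (J k)
  restart_primal : ∀ k, xbar (k + 1) 0 = xbar k (J k)
  restart_dual : ∀ k, y (k + 1) 0 = y k (J k)

/-- The Condat–Vũ iteration with primal step `t` and dual step `s` for `min f + g + Φ ∘ A`, where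
`A : H → E` and `E` carries the scalar product `ip`; `Astar` is the adjoint of `A`. -/
def IsCondatVuRun {E : Type*} [AddCommGroup E] [Module ℝ E] (ip : E → E → ℝ)
    (f : H → ℝ) (g : H → EReal) (Φ : E → EReal) (A : H → E) (t s : ℝ)
    (x : ℕ → H) (y : ℕ → E) : Prop :=
  ∃ Astar : E → H, (∀ a b, ip (A a) b = inner ℝ a (Astar b)) ∧
    ∀ k,
      IsProx (fun a b : H => inner ℝ a b) t g
        (x k - t • ∇ f (x k) - t • Astar (y k)) (x (k + 1)) ∧
      IsProx ip s (fenchelConj ip Φ)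
        (y k + s • A ((2 : ℝ) • x (k + 1) - x k)) (y (k + 1))

end Problem

/-! Part (a) is algebra. In the weighted scalar product the conjugate of a separable sum is `z ↦ ∑
i, (h i)^*(w i • z i)`, and its prox splits into coordinates. The factors `w i / γ` and `γ / w i` of
the algorithm are exactly those of this splitting.

For (b), scaling coordinate `i` by `√(w i)` identifies the weighted product with an `ℓ²` product.
The prox steps then become inclusions for `∂g` and `∂ψ`, with `ψ` the conjugate of the dual
function. They form a forward-backward step in the metric of `condatForm`. Monotonicity gives a
one-step inequality (`condatForm_le`). The explicit gradient is paid for by cocoercivity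
(Baillon–Haddad), which makes the iterates Fejér monotone (`fejer`). The budget is `1 / t = 1 / γ +
1 / (τ γ)`: the first summand exceeds `L / 2` and absorbs the gradient error, while the second
dominates the coupling `A`.

Increments therefore vanish, weak cluster points are primal-dual pairs
(`isPrimalDualPair_of_weak_limit`), and Opial's argument makes the cluster point unique
(`exists_weak_limit`). `IsSubgradient.of_fenchelConj` and convexity turn a pair into a minimizer. -/

section EpigraphCalculus

/-! ### Extended-real sums and epigraphs -/

/-- The two claims share one induction: regrouping the difference uses that the remaining sum is not
`⊥`. -/
theorem EReal.coe_sum_sub_sum {ι : Type*} (s : Finset ι) (r : ι → ℝ) (a : ι → EReal)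
    (ha : ∀ i, a i ≠ ⊥) :
    ((∑ i ∈ s, r i : ℝ) : EReal) - ∑ i ∈ s, a i = ∑ i ∈ s, ((r i : EReal) - a i) ∧
      ∑ i ∈ s, a i ≠ ⊥ := by
  classical
  induction s using Finset.induction_on with
  | empty => simp
  | insert j s hj ih =>
    rw [Finset.sum_insert hj, Finset.sum_insert hj, Finset.sum_insert hj, ← ih.1, EReal.coe_add,
      EReal.add_sub_add_comm (Or.inl (ha j)) (Or.inr ih.2)]
    exact ⟨rfl, EReal.add_ne_bot_iff.2 ⟨ha j, ih.2⟩⟩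

theorem EReal.sum_ne_bot {ι : Type*} (s : Finset ι) {a : ι → EReal} (ha : ∀ i, a i ≠ ⊥) :
    ∑ i ∈ s, a i ≠ ⊥ :=
  (EReal.coe_sum_sub_sum s (fun _ => 0) a ha).2

theorem EReal.coe_finsetSum {ι : Type*} (s : Finset ι) (r : ι → ℝ) :
    ((∑ i ∈ s, r i : ℝ) : EReal) = ∑ i ∈ s, (r i : EReal) := by
  classical
  induction s using Finset.induction_on with
  | empty => simp
  | insert j s hj ih => rw [Finset.sum_insert hj, Finset.sum_insert hj, EReal.coe_add, ih]

theorem EReal.coe_mul_finsetSum {ι : Type*} (s : Finset ι) {c : ℝ} (hc : 0 ≤ c) (a : ι → EReal) :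
    (c : EReal) * ∑ i ∈ s, a i = ∑ i ∈ s, (c : EReal) * a i := by
  classical
  induction s using Finset.induction_on with
  | empty => simp
  | insert j s hj ih =>
    rw [Finset.sum_insert hj, Finset.sum_insert hj,
      EReal.left_distrib_of_nonneg_of_ne_top (EReal.coe_nonneg.2 hc) (EReal.coe_ne_top c), ih]

/-- Suprema of separable sums are computed coordinatewise. -/
theorem EReal.iSup_pi_sum {ι : Type*} [DecidableEq ι] (s : Finset ι) {X : ι → Type*}
    [∀ i, Nonempty (X i)] (a : ∀ i, X i → EReal) :
    ⨆ x : ∀ i, X i, ∑ i ∈ s, a i (x i) = ∑ i ∈ s, ⨆ x, a i x := by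
  refine le_antisymm (iSup_le fun x => Finset.sum_le_sum fun i _ => le_iSup (a i) (x i)) ?_
  -- Generalizing over the upper bound lets the induction hypothesis be used with the smaller bound
  -- `b'`.
  suffices H : ∀ c : EReal, (∀ x : ∀ i, X i, ∑ i ∈ s, a i (x i) ≤ c) →
      ∑ i ∈ s, ⨆ x, a i x ≤ c from H _ fun x => le_iSup (fun x : ∀ i, X i => ∑ i ∈ s, a i (x i)) x
  induction s using Finset.induction_on with
  | empty => intro c hc; simpa using hc (Classical.arbitrary _)
  | insert j s hj ih =>
    intro c hc
    rw [Finset.sum_insert hj]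
    refine EReal.add_le_of_forall_lt fun a' ha' b' hb' => ?_
    obtain ⟨z, hz⟩ := lt_iSup_iff.1 ha'
    have : ∃ x : ∀ i, X i, b' < ∑ i ∈ s, a i (x i) := by
      by_contra hcon
      push Not at hcon
      exact absurd (ih b' hcon) (not_le.2 hb')
    obtain ⟨x, hx⟩ := this
    have h1 := hc (Function.update x j z)
    rw [Finset.sum_insert hj, Function.update_self] at h1
    have h2 : ∑ i ∈ s, a i (Function.update x j z i) = ∑ i ∈ s, a i (x i) :=
      Finset.sum_congr rfl fun i hi => by
        rw [Function.update_of_ne (ne_of_mem_of_not_mem hi hj)]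
    rw [h2] at h1
    exact (add_le_add hz.le hx.le).trans h1

/-- A height above the sum splits as `r + s` with `r` above `φ` and `s` above `ψ`. Excluding `⊥`
matters because `⊤ + ⊥ = ⊥` in `EReal`. -/
theorem convex_epigraph_add {E : Type*} [AddCommGroup E] [Module ℝ E] {φ ψ : E → EReal}
    (hφ : ∀ x, φ x ≠ ⊥) (hψ : ∀ x, ψ x ≠ ⊥)
    (cφ : Convex ℝ {p : E × ℝ | φ p.1 ≤ (p.2 : EReal)})
    (cψ : Convex ℝ {p : E × ℝ | ψ p.1 ≤ (p.2 : EReal)}) :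
    Convex ℝ {p : E × ℝ | φ p.1 + ψ p.1 ≤ (p.2 : EReal)} := by
  have key : ∀ p : E × ℝ, φ p.1 + ψ p.1 ≤ (p.2 : EReal) →
      ∃ r s : ℝ, φ p.1 ≤ r ∧ ψ p.1 ≤ s ∧ r + s = p.2 := by
    rintro ⟨x, t⟩ h
    dsimp only at h ⊢
    have h1 := hφ x
    have h2 := hψ x
    generalize φ x = a at *
    generalize ψ x = b at *
    induction a with
    | bot => exact absurd rfl h1
    | top => rw [EReal.top_add_of_ne_bot h2] at h; simp at h
    | coe r =>
      refine ⟨r, t - r, le_rfl, ?_, by ring⟩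
      rw [EReal.coe_sub]
      exact EReal.le_sub_iff_add_le (by simp) (by simp) |>.2 (by rwa [add_comm])
  intro p hp q hq a b ha hb hab
  obtain ⟨r, s, h1, h2, h3⟩ := key p hp
  obtain ⟨r', s', h1', h2', h3'⟩ := key q hq
  have e1 := cφ (show (p.1, r) ∈ _ from h1) (show (q.1, r') ∈ _ from h1') ha hb hab
  have e2 := cψ (show (p.1, s) ∈ _ from h2) (show (q.1, s') ∈ _ from h2') ha hb hab
  refine (add_le_add (Set.mem_ofPred_eq ▸ e1) (Set.mem_ofPred_eq ▸ e2)).trans (le_of_eq ?_)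
  simp only [Prod.snd_add, Prod.smul_snd, smul_eq_mul, ← EReal.coe_add]
  congr 1
  rw [← h3, ← h3']
  ring

theorem isClosed_epigraph_of_lowerSemicontinuous {E : Type*} [TopologicalSpace E] {φ : E → EReal}
    (h : LowerSemicontinuous φ) : IsClosed {p : E × ℝ | φ p.1 ≤ (p.2 : EReal)} :=
  (lowerSemicontinuous_iff_isClosed_epigraph.1 h).preimage
    (continuous_fst.prodMk (continuous_coe_real_ereal.comp continuous_snd))

theorem convex_epigraph_comp {E F : Type*} [AddCommGroup E] [Module ℝ E] [AddCommGroup F]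
    [Module ℝ F] {φ : F → EReal} (cφ : Convex ℝ {p : F × ℝ | φ p.1 ≤ (p.2 : EReal)})
    (T : E →ₗ[ℝ] F) : Convex ℝ {p : E × ℝ | φ (T p.1) ≤ (p.2 : EReal)} := by
  intro p hp q hq a b ha hb hab
  have := cφ (show (T p.1, p.2) ∈ _ from hp) (show (T q.1, q.2) ∈ _ from hq) ha hb hab
  simpa using this

theorem LowerSemicontinuous.ereal_add {E : Type*} [TopologicalSpace E] {φ ψ : E → EReal}
    (hφ : LowerSemicontinuous φ) (hψ : LowerSemicontinuous ψ) (bφ : ∀ x, φ x ≠ ⊥)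
    (bψ : ∀ x, ψ x ≠ ⊥) : LowerSemicontinuous fun x => φ x + ψ x :=
  hφ.add' hψ fun x => EReal.continuousAt_add (Or.inr (bψ x)) (Or.inl (bφ x))

end EpigraphCalculus

/-! ### Subgradients, proximal points and conjugates -/

section Hilbert

variable {H : Type*} [NormedAddCommGroup H] [InnerProductSpace ℝ H]

theorem IsGammaZero.exists_real {φ : H → EReal} (hφ : IsGammaZero φ) :
    ∃ (x : H) (r : ℝ), φ x = r := by
  obtain ⟨x, hx⟩ := hφ.exists_ne_top
  exact ⟨x, (φ x).toReal, (EReal.coe_toReal hx (hφ.ne_bot x)).symm⟩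

theorem IsGammaZero.eq_coe {φ : H → EReal} (hφ : IsGammaZero φ) {x : H} (hx : φ x ≠ ⊤) :
    ∃ r : ℝ, φ x = r := ⟨_, (EReal.coe_toReal hx (hφ.ne_bot x)).symm⟩

/-- A separable sum of functions in `Γ₀`, precomposed with continuous linear maps, is in `Γ₀`
as soon as it is proper. -/
theorem isGammaZero_sum_comp {ι : Type*} [Fintype ι] {G : ι → Type*}
    [∀ i, NormedAddCommGroup (G i)] [∀ i, InnerProductSpace ℝ (G i)] {h : ∀ i, G i → EReal}
    (hh : ∀ i, IsGammaZero (h i)) (T : ∀ i, H →L[ℝ] G i)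
    (hT : ∃ z, ∀ i, h i (T i z) ≠ ⊤) : IsGammaZero fun z => ∑ i, h i (T i z) := by
  classical
  have nb : ∀ (s : Finset ι) (z : H), ∑ i ∈ s, h i (T i z) ≠ ⊥ := fun s z =>
    EReal.sum_ne_bot s fun i => (hh i).ne_bot _
  have main : ∀ s : Finset ι, LowerSemicontinuous (fun z => ∑ i ∈ s, h i (T i z)) ∧
      Convex ℝ {p : H × ℝ | ∑ i ∈ s, h i (T i p.1) ≤ (p.2 : EReal)} := by
    intro s
    induction s using Finset.induction_on with
    | empty =>
      refine ⟨by simpa using lowerSemicontinuous_const, ?_⟩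
      have : {p : H × ℝ | ∑ i ∈ (∅ : Finset ι), h i (T i p.1) ≤ (p.2 : EReal)} =
          Set.univ ×ˢ Set.Ici 0 := by
        ext p; simp
      rw [this]
      exact convex_univ.prod (convex_Ici 0)
    | insert j s hj ih =>
      simp only [Finset.sum_insert hj]
      exact ⟨((hh j).lsc.comp (T j).continuous).ereal_add ih.1
          (fun _ => (hh j).ne_bot _) (nb s),
        convex_epigraph_add (fun _ => (hh j).ne_bot _) (nb s)
          (convex_epigraph_comp (hh j).convex_epigraph (T j).toLinearMap) ih.2⟩
  obtain ⟨z, hz⟩ := hT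
  refine ⟨nb _, ⟨z, ?_⟩, (main _).1, (main _).2⟩
  choose r hr using fun i => (hh i).eq_coe (hz i)
  simp only [hr, ← EReal.coe_finsetSum]
  exact EReal.coe_ne_top _

theorem IsSubgradient.exists_real {φ : H → EReal} (hφ : IsGammaZero φ) {x v : H}
    (h : IsSubgradient φ x v) : ∃ r : ℝ, φ x = r := by
  refine hφ.eq_coe fun htop => ?_
  obtain ⟨z, hz⟩ := hφ.exists_ne_top
  have := h z
  rw [htop, EReal.top_add_coe, top_le_iff] at this
  exact hz this

/-- The optimality condition of the proximal point. -/
theorem IsProx.isSubgradient {φ : H → EReal} (hφ : IsGammaZero φ) {lam : ℝ} (hlam : 0 < lam)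
    {u p : H} (h : IsProx (fun a b : H => inner ℝ a b) lam φ u p) :
    IsSubgradient φ p ((1 / lam) • (u - p)) := by
  have hp : φ p ≠ ⊤ := by
    intro htop
    obtain ⟨z, r, hz⟩ := hφ.exists_real
    have := h z
    rw [htop, hz, EReal.coe_mul_top_of_pos hlam, EReal.coe_add_top, ← EReal.coe_mul,
      ← EReal.coe_add] at this
    exact EReal.coe_ne_top _ (top_le_iff.1 this)
  obtain ⟨r, hr⟩ := hφ.eq_coe hp
  intro z
  by_cases hz : φ z = ⊤
  · rw [hz]; exact le_top
  obtain ⟨s, hs⟩ := hφ.eq_coe hz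
  rw [hr, hs, ← EReal.coe_add, EReal.coe_le_coe_iff, real_inner_smul_left]
  -- Compare `p` with the point at parameter `θ` on the segment to `z`, divide by `θ`, then let `θ →
  -- 0`.
  have key : ∀ θ : ℝ, 0 < θ → θ ≤ 1 →
      0 ≤ inner ℝ (p - u) (z - p) + lam * (s - r) + θ * (1 / 2 * ‖z - p‖ ^ 2) := by
    intro θ h0 h1
    have hc := hφ.convex_epigraph (show (p, r) ∈ _ from hr.le) (show (z, s) ∈ _ from hs.le)
      (sub_nonneg.2 h1) h0.le (by ring)
    have hc' : φ ((1 - θ) • p + θ • z) ≤ (((1 - θ) * r + θ * s : ℝ) : EReal) := hc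
    have h2 := (h ((1 - θ) • p + θ • z)).trans (add_le_add le_rfl
      (mul_le_mul_of_nonneg_left hc' (EReal.coe_nonneg.2 hlam.le)))
    rw [hr, ← EReal.coe_mul, ← EReal.coe_add, ← EReal.coe_mul, ← EReal.coe_add,
      EReal.coe_le_coe_iff] at h2
    have e : (1 - θ) • p + θ • z - u = (p - u) + θ • (z - p) := by module
    rw [e] at h2
    dsimp only at h2
    rw [inner_add_left (p - u), inner_add_right, inner_add_right, real_inner_smul_left,
      real_inner_smul_right, real_inner_smul_right, real_inner_smul_left,
      real_inner_self_eq_norm_sq (z - p), real_inner_comm (p - u) (z - p)] at h2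
    have h3 : 0 ≤ θ * (inner ℝ (p - u) (z - p) + lam * (s - r) + θ * (1 / 2 * ‖z - p‖ ^ 2)) := by
      linarith
    exact nonneg_of_mul_nonneg_right h3 h0
  have lim : 0 ≤ inner ℝ (p - u) (z - p) + lam * (s - r) := by
    have ht : Tendsto (fun θ : ℝ => inner ℝ (p - u) (z - p) + lam * (s - r) +
        θ * (1 / 2 * ‖z - p‖ ^ 2)) (𝓝[>] 0)
        (𝓝 (inner ℝ (p - u) (z - p) + lam * (s - r) + 0 * (1 / 2 * ‖z - p‖ ^ 2))) :=
      (Continuous.tendsto (by fun_prop) 0).mono_left nhdsWithin_le_nhds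
    have := ge_of_tendsto ht (by
      filter_upwards [Ioc_mem_nhdsGT (zero_lt_one' ℝ)] with θ hθ using key θ hθ.1 hθ.2)
    simpa using this
  have e : inner ℝ (u - p) (z - p) = - inner ℝ (p - u) (z - p) := by
    rw [← inner_neg_left, neg_sub]
  rw [e, one_div, ← sub_nonneg]
  have : s - (r + lam⁻¹ * -inner ℝ (p - u) (z - p)) =
      lam⁻¹ * (inner ℝ (p - u) (z - p) + lam * (s - r)) := by
    field_simp; ring
  rw [this]
  positivity

/-- Testing against real epigraph points replaces `EReal` arithmetic by linear inequalities. -/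
theorem fenchelConj_le_coe_iff {E : Type*} {ip : E → E → ℝ} {φ : E → EReal} (hφ : ∀ x, φ x ≠ ⊥)
    {y : E} {r : ℝ} :
    fenchelConj ip φ y ≤ r ↔ ∀ (x : E) (s : ℝ), φ x ≤ s → ip x y ≤ r + s := by
  rw [fenchelConj, iSup_le_iff]
  refine forall_congr' fun x => ?_
  have h1 := hφ x
  generalize φ x = a at *
  induction a with
  | bot => exact absurd rfl h1
  | top => simp
  | coe t =>
    rw [← EReal.coe_sub, EReal.coe_le_coe_iff]
    simp only [EReal.coe_le_coe_iff]
    exact ⟨fun h s hs => by linarith, fun h => by linarith [h t le_rfl]⟩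

theorem le_fenchelConj_of_eq_coe {E : Type*} {ip : E → E → ℝ} {φ : E → EReal} {x : E} {r : ℝ}
    (h : φ x = r) (y : E) : ((ip x y - r : ℝ) : EReal) ≤ fenchelConj ip φ y := by
  refine le_trans (le_of_eq ?_) (le_iSup _ x)
  rw [h, EReal.coe_sub]

/-- A supremum of continuous affine functions is closed and convex. Finiteness somewhere is assumed,
since a known subgradient will supply it. -/
theorem IsGammaZero.fenchelConj {φ : H → EReal} (hφ : IsGammaZero φ)
    (hfin : ∃ v, fenchelConj (fun a b : H => inner ℝ a b) φ v ≠ ⊤) :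
    IsGammaZero (fenchelConj (fun a b : H => inner ℝ a b) φ) where
  ne_bot y := by
    obtain ⟨x, r, hr⟩ := hφ.exists_real
    exact ne_bot_of_le_ne_bot (EReal.coe_ne_bot _) (le_fenchelConj_of_eq_coe hr y)
  exists_ne_top := hfin
  lsc := by
    refine lowerSemicontinuous_iSup fun x => Continuous.lowerSemicontinuous ?_
    have h1 := hφ.ne_bot x
    generalize φ x = a at *
    induction a with
    | bot => exact absurd rfl h1
    | top => simpa using continuous_const
    | coe t =>
      simp only [← EReal.coe_sub]
      exact continuous_coe_real_ereal.comp (by fun_prop)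
  convex_epigraph := by
    simp only [fenchelConj_le_coe_iff hφ.ne_bot]
    intro p hp q hq a b ha hb hab x s hs
    have h1 := hp x s hs
    have h2 := hq x s hs
    simp only [Prod.fst_add, Prod.smul_fst, Prod.snd_add, Prod.smul_snd, smul_eq_mul,
      inner_add_right, real_inner_smul_right]
    have h3 := mul_le_mul_of_nonneg_left h1 ha
    have h4 := mul_le_mul_of_nonneg_left h2 hb
    have : s = a * s + b * s := by rw [← add_mul, hab, one_mul]
    linarith

theorem IsSubgradient.fenchelConj_eq {φ : H → EReal} {x v : H} {r : ℝ} (hφ : ∀ x, φ x ≠ ⊥)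
    (hr : φ x = r) (h : IsSubgradient φ x v) :
    fenchelConj (fun a b : H => inner ℝ a b) φ v = ((inner ℝ x v - r : ℝ) : EReal) := by
  refine le_antisymm ((fenchelConj_le_coe_iff hφ).2 fun z s hs => ?_)
    (le_fenchelConj_of_eq_coe (ip := fun a b : H => inner ℝ a b) hr v)
  have := (h z).trans hs
  rw [hr, ← EReal.coe_add, EReal.coe_le_coe_iff, inner_sub_right, real_inner_comm z,
    real_inner_comm x] at this
  linarith

theorem IsSubgradient.fenchelConj {φ : H → EReal} (hφ : IsGammaZero φ) {x v : H}
    (h : IsSubgradient φ x v) :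
    IsSubgradient (fenchelConj (fun a b : H => inner ℝ a b) φ) v x := by
  obtain ⟨r, hr⟩ := h.exists_real hφ
  intro w
  rw [h.fenchelConj_eq hφ.ne_bot hr, ← EReal.coe_add]
  refine le_trans (le_of_eq ?_)
    (le_fenchelConj_of_eq_coe (ip := fun a b : H => inner ℝ a b) hr w)
  rw [inner_sub_right]
  congr 1
  ring

/-- Subgradients of the conjugate are inverse subgradients; this is where the separation theorem
enters. -/
theorem IsSubgradient.of_fenchelConj [CompleteSpace H] {φ : H → EReal} (hφ : IsGammaZero φ)
    {x v : H} (hfin : ∃ w, _root_.fenchelConj (fun a b : H => inner ℝ a b) φ w ≠ ⊤)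
    (h : IsSubgradient (_root_.fenchelConj (fun a b : H => inner ℝ a b) φ) v x) :
    IsSubgradient φ x v := by
  obtain ⟨c, hc⟩ := h.exists_real (hφ.fenchelConj hfin)
  have hle := (fenchelConj_le_coe_iff hφ.ne_bot).1 hc.le
  have hsub : ∀ (w : H) (t : ℝ), (∀ (a : H) (s : ℝ), φ a ≤ s → inner ℝ a w ≤ t + s) →
      c + inner ℝ x (w - v) ≤ t := by
    intro w t hw
    have := (h w).trans ((fenchelConj_le_coe_iff hφ.ne_bot).2 hw)
    rwa [hc, ← EReal.coe_add, EReal.coe_le_coe_iff] at this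
  -- This is equality in Fenchel–Young. Otherwise the point lies strictly outside the closed convex
  -- epigraph and can be separated from it.
  have hx : φ x ≤ ((inner ℝ x v - c : ℝ) : EReal) := by
    by_contra hcon
    obtain ⟨l, u, hl1, hl2⟩ := geometric_hahn_banach_point_closed
      (x := (x, inner ℝ x v - c)) hφ.convex_epigraph
      (isClosed_epigraph_of_lowerSemicontinuous hφ.lsc) hcon
    set p : H := (InnerProductSpace.toDual ℝ H).symm (l.comp (ContinuousLinearMap.inl ℝ H ℝ))
    set κ : ℝ := l (0, 1)
    have hl : ∀ (a : H) (s : ℝ), l (a, s) = inner ℝ a p + κ * s := by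
      intro a s
      have e : ((a, s) : H × ℝ) = (a, 0) + s • (0, 1) := by simp
      rw [e, map_add, map_smul, real_inner_comm, InnerProductSpace.toDual_symm_apply]
      simp [κ, mul_comm]
    rw [hl] at hl1
    have hl2' : ∀ (a : H) (s : ℝ), φ a ≤ s → u < inner ℝ a p + κ * s := fun a s has => by
      rw [← hl]; exact hl2 (a, s) has
    obtain ⟨z, r, hz⟩ := hφ.exists_real
    have hκ : 0 ≤ κ := by
      by_contra hneg
      push Not at hneg
      obtain ⟨n, hn⟩ := exists_nat_gt ((u - inner ℝ z p - κ * r) / κ)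
      have h1 := hl2' z (r + n) (by rw [hz]; exact_mod_cast by simp)
      rw [div_lt_iff_of_neg hneg] at hn
      linarith
    -- A vertical hyperplane is tilted by testing the conjugate at `v - p`; a non-vertical one is an
    -- affine minorant of slope `-p / κ`.
    rcases hκ.eq_or_lt with h0 | hpos
    · rw [← h0] at hl1 hl2'
      have := hsub (v - p) (c - u) fun a s has => by
        have h1 := hle a s has
        have h2 := hl2' a s has
        rw [inner_sub_right]
        linarith
      rw [sub_sub_cancel_left, inner_neg_right] at this
      linarith
    · have := hsub (-(1 / κ) • p) (-(u / κ)) fun a s has => by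
        have h2 := hl2' a s has
        rw [real_inner_smul_right]
        rw [← sub_nonneg]
        have : -(u / κ) + s - -(1 / κ) * inner ℝ a p = (inner ℝ a p + κ * s - u) / κ := by
          field_simp; ring
        rw [this]
        exact div_nonneg (by linarith) hpos.le
      rw [inner_sub_right, real_inner_smul_right] at this
      have h3 : (inner ℝ x p + κ * (inner ℝ x v - c) - u) / κ < 0 :=
        div_neg_of_neg_of_pos (by linarith) hpos
      have h4 : (inner ℝ x p + κ * (inner ℝ x v - c) - u) / κ =
          (1 / κ) * inner ℝ x p + (inner ℝ x v - c) - u / κ := by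
        field_simp
      linarith
  intro z
  by_cases hz : φ z = ⊤
  · rw [hz]; exact le_top
  obtain ⟨s, hs⟩ := hφ.eq_coe hz
  have h1 := hle z s hs.le
  refine (add_le_add hx le_rfl).trans ?_
  rw [hs, ← EReal.coe_add, EReal.coe_le_coe_iff, inner_sub_right, real_inner_comm z,
    real_inner_comm x]
  linarith

/-- A weakly convergent bounded sequence tested against a strongly convergent one. -/
theorem tendsto_inner_of_strong_weak {ι : Type*} {l : Filter ι} {a x : ι → H} {a₀ x₀ : H} {M : ℝ}
    (hM : ∀ k, ‖x k‖ ≤ M) (ha : Tendsto a l (𝓝 a₀))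
    (hx : ∀ v, Tendsto (fun k => inner ℝ v (x k)) l (𝓝 (inner ℝ v x₀))) :
    Tendsto (fun k => inner ℝ (a k) (x k)) l (𝓝 (inner ℝ a₀ x₀)) := by
  have h1 : Tendsto (fun k => inner ℝ (a k - a₀) (x k)) l (𝓝 0) := by
    refine squeeze_zero_norm (a := fun k => ‖a k - a₀‖ * M) (fun k => ?_) ?_
    · exact (norm_inner_le_norm _ _).trans (mul_le_mul_of_nonneg_left (hM k) (norm_nonneg _))
    · simpa using (tendsto_iff_norm_sub_tendsto_zero.1 ha).mul_const M
  simpa [inner_sub_left] using h1.add (hx a₀)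

end Hilbert

/-! ### Weak limits -/

section WeakLimits

variable {H K : Type*} [NormedAddCommGroup H] [InnerProductSpace ℝ H] [CompleteSpace H]
  [NormedAddCommGroup K] [InnerProductSpace ℝ K] [CompleteSpace K]

/-- Joint weak lower semicontinuity of `g ⊕ ψ`. -/
theorem IsGammaZero.add_le_of_weak_limit {ι : Type*} {l : Filter ι} [NeBot l] {g : H → EReal}
    {ψ : K → EReal} (hg : IsGammaZero g) (hψ : IsGammaZero ψ) {x : ι → H} {η : ι → K}
    {R : ι → ℝ} {x₀ : H} {η₀ : K} {R₀ : ℝ}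
    (hx : ∀ v, Tendsto (fun k => inner ℝ v (x k)) l (𝓝 (inner ℝ v x₀)))
    (hη : ∀ v, Tendsto (fun k => inner ℝ v (η k)) l (𝓝 (inner ℝ v η₀)))
    (hR : Tendsto R l (𝓝 R₀)) (h : ∀ k, g (x k) + ψ (η k) ≤ R k) :
    g x₀ + ψ η₀ ≤ R₀ := by
  have hconv : Convex ℝ {p : (H × K) × ℝ | g p.1.1 + ψ p.1.2 ≤ (p.2 : EReal)} :=
    convex_epigraph_add (φ := fun q : H × K => g q.1) (ψ := fun q : H × K => ψ q.2)
      (fun q => hg.ne_bot _) (fun q => hψ.ne_bot _)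
      (convex_epigraph_comp hg.convex_epigraph (LinearMap.fst ℝ H K))
      (convex_epigraph_comp hψ.convex_epigraph (LinearMap.snd ℝ H K))
  have hclosed : IsClosed {p : (H × K) × ℝ | g p.1.1 + ψ p.1.2 ≤ (p.2 : EReal)} :=
    isClosed_epigraph_of_lowerSemicontinuous (φ := fun q : H × K => g q.1 + ψ q.2)
      (LowerSemicontinuous.ereal_add (hg.lsc.comp continuous_fst)
        (hψ.lsc.comp continuous_snd) (fun q => hg.ne_bot _) (fun q => hψ.ne_bot _))
  by_contra hcon
  -- Mazur: a functional strictly separating the limit from the closed convex epigraph is weakly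
  -- continuous, hence contradicts `h`.
  obtain ⟨f, u, h1, h2⟩ := geometric_hahn_banach_point_closed (x := ((x₀, η₀), R₀))
    hconv hclosed hcon
  set p : H := (InnerProductSpace.toDual ℝ H).symm
    ((f.comp (ContinuousLinearMap.inl ℝ (H × K) ℝ)).comp (ContinuousLinearMap.inl ℝ H K))
  set q : K := (InnerProductSpace.toDual ℝ K).symm
    ((f.comp (ContinuousLinearMap.inl ℝ (H × K) ℝ)).comp (ContinuousLinearMap.inr ℝ H K))
  have hf : ∀ (a : H) (b : K) (s : ℝ),
      f ((a, b), s) = inner ℝ p a + inner ℝ q b + s * f ((0, 0), 1) := by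
    intro a b s
    have e : (((a, b), s) : (H × K) × ℝ) = ((a, 0), 0) + ((0, b), 0) + s • ((0, 0), 1) := by simp
    rw [e, map_add, map_add, map_smul, InnerProductSpace.toDual_symm_apply,
      InnerProductSpace.toDual_symm_apply]
    rfl
  have ht : Tendsto (fun k => f ((x k, η k), R k)) l (𝓝 (f ((x₀, η₀), R₀))) := by
    rw [hf]
    exact (((hx p).add (hη q)).add (hR.mul_const _)).congr fun k => (hf _ _ _).symm
  have := ge_of_tendsto' ht fun k => (h2 ((x k, η k), R k) (h k)).le
  exact absurd h1 (not_lt.2 this)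

/-- Bounded sequences have weak limits along every ultrafilter. -/
theorem exists_weak_limit_of_bounded {ι : Type*} (U : Ultrafilter ι) {x : ι → H} {M : ℝ}
    (hx : ∀ k, ‖x k‖ ≤ M) :
    ∃ x₀ : H, ∀ v, Tendsto (fun k => inner ℝ v (x k)) U (𝓝 (inner ℝ v x₀)) := by
  -- Banach–Alaoglu along an ultrafilter avoids extracting subsequences.
  have hc := WeakDual.isCompact_closedBall (𝕜 := ℝ) (E := H) 0 M
  let F : ι → WeakDual ℝ H := fun k => StrongDual.toWeakDual (InnerProductSpace.toDual ℝ H (x k))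
  obtain ⟨ξ, -, hξ⟩ := hc.ultrafilter_le_nhds (U.map F) (by
    rw [le_principal_iff]
    refine Ultrafilter.mem_coe.2 (Ultrafilter.mem_map.2 (Filter.mem_of_superset Filter.univ_mem ?_))
    intro k _
    simpa [F] using hx k)
  have hξ' : Tendsto F U (𝓝 ξ) := hξ
  refine ⟨(InnerProductSpace.toDual ℝ H).symm (WeakDual.toStrongDual ξ), fun v => ?_⟩
  have := ((WeakDual.eval_continuous v).tendsto ξ).comp hξ'
  rw [real_inner_comm, InnerProductSpace.toDual_symm_apply]
  refine this.congr fun k => ?_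
  simp [F, real_inner_comm]

theorem tendsto_toWeakSpace_of_inner {ι : Type*} {l : Filter ι} {x : ι → H} {x₀ : H}
    (h : ∀ v, Tendsto (fun k => inner ℝ v (x k)) l (𝓝 (inner ℝ v x₀))) :
    Tendsto (fun k => toWeakSpace ℝ H (x k)) l (𝓝 (toWeakSpace ℝ H x₀)) := by
  refine (WeakBilin.tendsto_iff_forall_eval_tendsto (topDualPairing ℝ H).flip ?_).2 fun φ => ?_
  · intro a b hab
    refine ext_inner_left ℝ fun v => ?_
    simpa using DFunLike.congr_fun hab (InnerProductSpace.toDual ℝ H v)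
  · have := h ((InnerProductSpace.toDual ℝ H).symm φ)
    simp only [InnerProductSpace.toDual_symm_apply] at this
    exact this

end WeakLimits

/-! ### Convex functions with Lipschitz gradient -/

section Gradient

variable {H : Type*} [NormedAddCommGroup H] [InnerProductSpace ℝ H] [CompleteSpace H]

theorem hasDerivAt_comp_line {f : H → ℝ} (hf : Differentiable ℝ f) (a v : H) (t : ℝ) :
    HasDerivAt (fun t : ℝ => f (a + t • v)) (inner ℝ (∇ f (a + t • v)) v) t := by
  have h1 := (hf (a + t • v)).hasGradientAt.hasFDerivAt
  have h2 : HasDerivAt (fun t : ℝ => a + t • v) v t := by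
    simpa using ((hasDerivAt_id t).smul_const v).const_add a
  have h3 := h1.comp_hasDerivAt t h2
  rw [InnerProductSpace.toDual_apply_apply] at h3
  exact h3

theorem ConvexOn.add_inner_gradient_le {f : H → ℝ} (hc : ConvexOn ℝ Set.univ f)
    (hf : Differentiable ℝ f) (a b : H) : f a + inner ℝ (∇ f a) (b - a) ≤ f b := by
  have hφ : ConvexOn ℝ Set.univ (fun t : ℝ => f (a + t • (b - a))) := by
    refine ⟨convex_univ, fun s _ t _ α β hα hβ hαβ => ?_⟩
    have := hc.2 (Set.mem_univ (a + s • (b - a))) (Set.mem_univ (a + t • (b - a))) hα hβ hαβ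
    refine le_trans (le_of_eq ?_) this
    dsimp only
    congr 1
    have : a = α • a + β • a := by rw [← add_smul, hαβ, one_smul]
    nth_rewrite 1 [this]
    simp only [smul_eq_mul]
    module
  have h0 := hasDerivAt_comp_line hf a (b - a) 0
  have := hφ.le_slope_of_hasDerivAt (Set.mem_univ 0) (Set.mem_univ 1) zero_lt_one h0
  rw [slope_def_field, zero_smul, one_smul, add_zero, add_sub_cancel, sub_zero, div_one] at this
  linarith

/-- Along the segment, `f` minus the non-constant part of the quadratic bound has nonpositive
derivative, so no integration is needed. -/
theorem descent_lemma {f : H → ℝ} (hf : Differentiable ℝ f) {L : ℝ}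
    (hL : ∀ a b : H, ‖∇ f a - ∇ f b‖ ≤ L * ‖a - b‖) (a v : H) :
    f (a + v) ≤ f a + inner ℝ (∇ f a) v + L / 2 * ‖v‖ ^ 2 := by
  let φ : ℝ → ℝ := fun t => f (a + t • v) - t * inner ℝ (∇ f a) v - t ^ 2 * (L / 2 * ‖v‖ ^ 2)
  have hd : ∀ t, HasDerivAt φ (inner ℝ (∇ f (a + t • v)) v - inner ℝ (∇ f a) v -
      2 * t * (L / 2 * ‖v‖ ^ 2)) t := by
    intro t
    have h1 := ((hasDerivAt_comp_line hf a v t).sub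
      ((hasDerivAt_id t).mul_const (inner ℝ (∇ f a) v))).sub
      ((hasDerivAt_pow 2 t).mul_const (L / 2 * ‖v‖ ^ 2))
    refine h1.congr_deriv ?_
    norm_num
  have hanti : AntitoneOn φ (Set.Icc 0 1) := by
    refine antitoneOn_of_deriv_nonpos (convex_Icc 0 1)
      (fun t _ => (hd t).continuousAt.continuousWithinAt)
      (fun t _ => (hd t).differentiableAt.differentiableWithinAt) fun t ht => ?_
    rw [interior_Icc] at ht
    rw [(hd t).deriv, ← inner_sub_left]
    have h1 := real_inner_le_norm (∇ f (a + t • v) - ∇ f a) v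
    have h2 := hL (a + t • v) a
    rw [add_sub_cancel_left, norm_smul, Real.norm_of_nonneg ht.1.le] at h2
    have h3 := mul_le_mul_of_nonneg_right h2 (norm_nonneg v)
    nlinarith
  have := hanti (Set.left_mem_Icc.2 zero_le_one) (Set.right_mem_Icc.2 zero_le_one) zero_le_one
  simp only [φ, one_smul, zero_smul, add_zero, one_mul, one_pow, zero_mul, sub_zero,
    zero_pow two_ne_zero] at this
  linarith

/-- The Baillon–Haddad theorem: the gradient of a convex function is cocoercive. -/
theorem ConvexOn.gradient_cocoercive {f : H → ℝ} (hc : ConvexOn ℝ Set.univ f)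
    (hf : Differentiable ℝ f) {L : ℝ} (hL0 : 0 < L)
    (hL : ∀ a b : H, ‖∇ f a - ∇ f b‖ ≤ L * ‖a - b‖) (a b : H) :
    1 / L * ‖∇ f a - ∇ f b‖ ^ 2 ≤ inner ℝ (∇ f a - ∇ f b) (a - b) := by
  -- The step `-(1 / L) • D` from `b` minimizes the descent bound for `f - ⟨∇ f a, ·⟩`. Adding the
  -- inequality with `a`, `b` exchanged gives cocoercivity.
  have half : ∀ a b : H, f a + inner ℝ (∇ f a) (b - a) + 1 / (2 * L) * ‖∇ f b - ∇ f a‖ ^ 2 ≤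
      f b := by
    intro a b
    set D := ∇ f b - ∇ f a with hD
    have h1 := descent_lemma hf hL b (-(1 / L) • D)
    have h2 := hc.add_inner_gradient_le hf a (b + -(1 / L) • D)
    have e : b + -(1 / L) • D - a = (b - a) + -(1 / L) • D := by abel
    rw [e, inner_add_right, real_inner_smul_right] at h2
    rw [real_inner_smul_right, norm_smul, mul_pow, Real.norm_eq_abs, sq_abs] at h1
    have h3 : inner ℝ (∇ f b) D - inner ℝ (∇ f a) D = ‖D‖ ^ 2 := by
      rw [← inner_sub_left, ← hD, real_inner_self_eq_norm_sq]
    have h4 : L / 2 * ((-(1 / L)) ^ 2 * ‖D‖ ^ 2) = 1 / (2 * L) * ‖D‖ ^ 2 := by field_simp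
    have h5 : 1 / L * ‖D‖ ^ 2 = 2 * (1 / (2 * L) * ‖D‖ ^ 2) := by field_simp
    have h6 : 1 / L * inner ℝ (∇ f b) D - 1 / L * inner ℝ (∇ f a) D = 1 / L * ‖D‖ ^ 2 := by
      rw [← h3]; ring
    linarith
  have h1 := half a b
  have h2 := half b a
  rw [norm_sub_rev] at h1
  have e : inner ℝ (∇ f a - ∇ f b) (a - b) =
      - inner ℝ (∇ f a) (b - a) - inner ℝ (∇ f b) (a - b) := by
    rw [inner_sub_left, ← inner_neg_right, neg_sub]
  have h5 : 1 / L * ‖∇ f a - ∇ f b‖ ^ 2 = 2 * (1 / (2 * L) * ‖∇ f a - ∇ f b‖ ^ 2) := by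
    field_simp
  rw [e, h5]
  linarith

end Gradient

/-! ### Convergence of the Condat–Vũ inclusion -/

section CondatVu

variable {H K : Type*} [NormedAddCommGroup H] [InnerProductSpace ℝ H]
  [NormedAddCommGroup K] [InnerProductSpace ℝ K]

theorem IsSubgradient.monotone {φ : H → EReal} (hφ : IsGammaZero φ) {a b v w : H}
    (ha : IsSubgradient φ a v) (hb : IsSubgradient φ b w) : 0 ≤ inner ℝ (v - w) (a - b) := by
  obtain ⟨r, hr⟩ := ha.exists_real hφ
  obtain ⟨s, hs⟩ := hb.exists_real hφ
  have h1 := ha b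
  have h2 := hb a
  rw [hr, hs, ← EReal.coe_add, EReal.coe_le_coe_iff] at h1 h2
  have h3 : inner ℝ v (b - a) = - inner ℝ v (a - b) := by rw [← inner_neg_right, neg_sub]
  rw [inner_sub_left]
  linarith

/-- The quadratic form of the metric in which the Condat–Vũ iteration is a forward-backward
iteration. -/
noncomputable def condatForm (t s : ℝ) (A : H →L[ℝ] K) (X : H) (Y : K) : ℝ :=
  1 / t * ‖X‖ ^ 2 - 2 * inner ℝ (A X) Y + 1 / s * ‖Y‖ ^ 2

/-- Only `μ` is spent on the cross term; `κ` is kept for the gradient step. -/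
theorem condatForm_coercive {t s κ μ b : ℝ} (hs : 0 < s) (ht : 1 / t = κ + μ) (hμ : 0 < μ)
    {A : H →L[ℝ] K} (hA : ∀ v, ‖A v‖ ≤ b * ‖v‖) (hsb : s * b ^ 2 < μ) :
    ∃ c > 0, ∀ X Y, κ * ‖X‖ ^ 2 + c * (‖X‖ ^ 2 + ‖Y‖ ^ 2) ≤ condatForm t s A X Y := by
  have hs' : 0 < 1 / s := by positivity
  have hdet : 0 < μ * (1 / s) - b ^ 2 := by
    have : μ * (1 / s) - b ^ 2 = (μ - s * b ^ 2) / s := by field_simp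
    rw [this]
    exact div_pos (by linarith) hs
  have hsum : 0 < μ + 1 / s := by positivity
  -- Determinant over trace of `[[μ, -b], [-b, 1 / s]]`, a lower bound for its smaller eigenvalue.
  refine ⟨(μ * (1 / s) - b ^ 2) / (μ + 1 / s), by positivity, fun X Y => ?_⟩
  set c := (μ * (1 / s) - b ^ 2) / (μ + 1 / s) with hc
  have hc0 : 0 < c := by positivity
  have hc1 : c * (μ + 1 / s) = μ * (1 / s) - b ^ 2 := div_mul_cancel₀ _ hsum.ne'
  have h1 : inner ℝ (A X) Y ≤ b * (‖X‖ * ‖Y‖) :=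
    (real_inner_le_norm _ _).trans (by
      rw [← mul_assoc]; exact mul_le_mul_of_nonneg_right (hA X) (norm_nonneg _))
  have hμc : 0 < μ - c := by
    have : (μ - c) * (μ + 1 / s) = μ ^ 2 + b ^ 2 := by rw [sub_mul, hc1]; ring
    exact pos_of_mul_pos_left (by rw [this]; positivity) hsum.le
  have h2 : 0 ≤ (μ - c) * ‖X‖ ^ 2 - 2 * (b * (‖X‖ * ‖Y‖)) + (1 / s - c) * ‖Y‖ ^ 2 := by
    have h3 : (μ - c) * ((μ - c) * ‖X‖ ^ 2 - 2 * (b * (‖X‖ * ‖Y‖)) + (1 / s - c) * ‖Y‖ ^ 2) =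
        ((μ - c) * ‖X‖ - b * ‖Y‖) ^ 2 + c ^ 2 * ‖Y‖ ^ 2 := by
      linear_combination (-‖Y‖ ^ 2) * hc1
    exact nonneg_of_mul_nonneg_right (by rw [h3]; positivity) hμc
  rw [condatForm, ht]
  linarith

theorem tendsto_zero_of_sq_norm_le {E : Type*} [NormedAddCommGroup E] {a : ℕ → E} {r : ℕ → ℝ}
    (h : ∀ k, ‖a k‖ ^ 2 ≤ r k) (hr : Tendsto r atTop (𝓝 0)) : Tendsto a atTop (𝓝 0) := by
  have h1 : Tendsto (fun k => ‖a k‖ ^ 2) atTop (𝓝 0) :=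
    squeeze_zero (fun k => by positivity) h hr
  have h2 := (Real.continuous_sqrt.tendsto 0).comp h1
  rw [Real.sqrt_zero] at h2
  refine tendsto_zero_iff_norm_tendsto_zero.2 (h2.congr fun k => ?_)
  simp [Real.sqrt_sq (norm_nonneg _)]

/-- The form is nonincreasing and bounded below, so its decrements tend to zero, and they dominate
the three squared norms. -/
theorem asymptotics_of_fejer {C : H → H} {A : H →L[ℝ] K} {t s : ℝ} {x : ℕ → H}
    {η : ℕ → K} {c : ℝ} (hc : 0 < c)
    (hform : ∀ X Y, c * (‖X‖ ^ 2 + ‖Y‖ ^ 2) ≤ condatForm t s A X Y) {p : H} {q : K}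
    (h : ∀ k, condatForm t s A (x (k + 1) - p) (η (k + 1) - q) +
          c * (‖x k - x (k + 1)‖ ^ 2 + ‖η k - η (k + 1)‖ ^ 2 + ‖C (x k) - C p‖ ^ 2) ≤
        condatForm t s A (x k - p) (η k - q)) :
    (∃ ℓ, Tendsto (fun k => condatForm t s A (x k - p) (η k - q)) atTop (𝓝 ℓ)) ∧
    (∃ M, ∀ k, ‖x k‖ ≤ M ∧ ‖η k‖ ≤ M) ∧
    Tendsto (fun k => x k - x (k + 1)) atTop (𝓝 0) ∧
    Tendsto (fun k => η k - η (k + 1)) atTop (𝓝 0) ∧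
    Tendsto (fun k => C (x k)) atTop (𝓝 (C p)) := by
  set a : ℕ → ℝ := fun k => condatForm t s A (x k - p) (η k - q) with ha
  have hanti : Antitone a := antitone_nat_of_succ_le fun k => by
    have h1 := h k
    have : 0 ≤ c * (‖x k - x (k + 1)‖ ^ 2 + ‖η k - η (k + 1)‖ ^ 2 + ‖C (x k) - C p‖ ^ 2) := by
      positivity
    simp only [ha]
    linarith
  have hpos : ∀ k, 0 ≤ a k := fun k => le_trans (by positivity) (hform _ _)
  have hlim := tendsto_atTop_ciInf hanti ⟨0, by rintro _ ⟨k, rfl⟩; exact hpos k⟩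
  have hdiff : Tendsto (fun k => 1 / c * (a k - a (k + 1))) atTop (𝓝 0) := by
    simpa using (hlim.sub (hlim.comp (tendsto_add_atTop_nat 1))).const_mul (1 / c)
  have hbd : ∀ k, ‖x k - x (k + 1)‖ ^ 2 + ‖η k - η (k + 1)‖ ^ 2 + ‖C (x k) - C p‖ ^ 2 ≤
      1 / c * (a k - a (k + 1)) := by
    intro k
    have h1 := h k
    rw [one_div, ← div_eq_inv_mul, le_div_iff₀ hc]
    simp only [ha]
    linarith
  refine ⟨⟨_, hlim⟩, ?_, ?_, ?_, ?_⟩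
  · have hsq : ∀ k, ‖x k - p‖ ^ 2 + ‖η k - q‖ ^ 2 ≤ a 0 / c := fun k => by
      rw [le_div_iff₀ hc, mul_comm]
      exact (hform _ _).trans (hanti (Nat.zero_le k))
    refine ⟨√(a 0 / c) + ‖p‖ + ‖q‖, fun k => ⟨?_, ?_⟩⟩
    · have h1 : ‖x k - p‖ ≤ √(a 0 / c) :=
        Real.le_sqrt_of_sq_le (by linarith [hsq k, sq_nonneg ‖η k - q‖])
      have h2 := norm_sub_norm_le (x k) p
      linarith [norm_nonneg q]
    · have h1 : ‖η k - q‖ ≤ √(a 0 / c) :=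
        Real.le_sqrt_of_sq_le (by linarith [hsq k, sq_nonneg ‖x k - p‖])
      have h2 := norm_sub_norm_le (η k) q
      linarith [norm_nonneg p]
  · exact tendsto_zero_of_sq_norm_le
      (fun k => by linarith [hbd k, sq_nonneg ‖η k - η (k + 1)‖, sq_nonneg ‖C (x k) - C p‖]) hdiff
  · exact tendsto_zero_of_sq_norm_le
      (fun k => by linarith [hbd k, sq_nonneg ‖x k - x (k + 1)‖, sq_nonneg ‖C (x k) - C p‖]) hdiff
  · refine tendsto_sub_nhds_zero_iff.1 (tendsto_zero_of_sq_norm_le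
      (fun k => by linarith [hbd k, sq_nonneg ‖x k - x (k + 1)‖, sq_nonneg ‖η k - η (k + 1)‖])
      hdiff)

variable [CompleteSpace H] [CompleteSpace K]

/-- Primal-dual optimality pairs for the cocoercive operator `C` and the functions `g`, `ψ`. -/
def IsPrimalDualPair (C : H → H) (g : H → EReal) (ψ : K → EReal) (A : H →L[ℝ] K)
    (p : H) (q : K) : Prop :=
  IsSubgradient g p (-(C p) - A.adjoint q) ∧ IsSubgradient ψ q (A p)

/-- The inclusion form of the Condat–Vũ iteration. -/
def IsCondatVuInclusion (C : H → H) (g : H → EReal) (ψ : K → EReal) (A : H →L[ℝ] K) (t s : ℝ)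
    (x : ℕ → H) (η : ℕ → K) : Prop :=
  ∀ k, IsSubgradient g (x (k + 1)) ((1 / t) • (x k - x (k + 1)) - C (x k) - A.adjoint (η k)) ∧
    IsSubgradient ψ (η (k + 1)) ((1 / s) • (η k - η (k + 1)) + A ((2 : ℝ) • x (k + 1) - x k))

variable {C : H → H} {g : H → EReal} {ψ : K → EReal} {A : H →L[ℝ] K} {t s : ℝ}
  {x : ℕ → H} {η : ℕ → K}

/-- Add the monotonicity inequalities of the two subdifferentials. The extrapolation `2 x (k + 1) -
x k` makes the coupling terms symmetric, so the sum is a polarization identity for `condatForm`. -/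
theorem IsCondatVuInclusion.condatForm_le (hg : IsGammaZero g) (hψ : IsGammaZero ψ)
    (hrun : IsCondatVuInclusion C g ψ A t s x η) {p : H} {q : K}
    (hpq : IsPrimalDualPair C g ψ A p q) (k : ℕ) :
    condatForm t s A (x (k + 1) - p) (η (k + 1) - q) +
      condatForm t s A (x k - x (k + 1)) (η k - η (k + 1)) +
      2 * inner ℝ (C (x k) - C p) (x (k + 1) - p) ≤ condatForm t s A (x k - p) (η k - q) := by
  have h1 := (hrun k).1.monotone hg hpq.1
  have h2 := (hrun k).2.monotone hψ hpq.2
  obtain ⟨X, hX⟩ : ∃ X, X = x (k + 1) - p := ⟨_, rfl⟩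
  obtain ⟨d, hd⟩ : ∃ d, d = x k - x (k + 1) := ⟨_, rfl⟩
  obtain ⟨Y, hY⟩ : ∃ Y, Y = η (k + 1) - q := ⟨_, rfl⟩
  obtain ⟨e, he⟩ : ∃ e, e = η k - η (k + 1) := ⟨_, rfl⟩
  have e1 : x k - p = X + d := by rw [hX, hd]; abel
  have e2 : η k - q = Y + e := by rw [hY, he]; abel
  have e3 : (1 / t) • (x k - x (k + 1)) - C (x k) - A.adjoint (η k) -
      (-(C p) - A.adjoint q) = (1 / t) • d - (C (x k) - C p) - A.adjoint (Y + e) := by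
    rw [← e2, map_sub, ← hd]; abel
  have e4 : (1 / s) • (η k - η (k + 1)) + A ((2 : ℝ) • x (k + 1) - x k) - A p =
      (1 / s) • e + A X - A d := by
    rw [← he, hX, hd, map_sub, map_sub, map_sub, map_smul, two_smul]; abel
  rw [e3, ← hX] at h1
  rw [e4, ← hY] at h2
  rw [e1, e2, ← hX, ← hY, ← hd, ← he]
  generalize C (x k) - C p = D at *
  simp only [inner_sub_left, inner_add_left, real_inner_smul_left,
    ContinuousLinearMap.adjoint_inner_left] at h1 h2
  simp only [condatForm, map_add, inner_add_left, inner_add_right, norm_add_sq_real]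
  rw [real_inner_comm X d, real_inner_comm (A X) Y, real_inner_comm (A X) e,
    real_inner_comm Y e] at *
  nlinarith

variable {L κ μ b : ℝ}

/-- Write `x (k + 1) - p` as `x k - p` minus the increment. Cocoercivity bounds the first part and
Young's inequality with weight `κ` the second, leaving `2 / L - 1 / κ > 0`. -/
theorem IsCondatVuInclusion.fejer (hg : IsGammaZero g) (hψ : IsGammaZero ψ) (hL : 0 < L)
    (hC : ∀ a b, 1 / L * ‖C a - C b‖ ^ 2 ≤ inner ℝ (C a - C b) (a - b)) (hs : 0 < s)
    (ht : 1 / t = κ + μ) (hκ : L / 2 < κ) (hμ : 0 < μ)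
    (hA : ∀ v, ‖A v‖ ≤ b * ‖v‖) (hsb : s * b ^ 2 < μ)
    (hrun : IsCondatVuInclusion C g ψ A t s x η) :
    ∃ c > 0, (∀ X Y, c * (‖X‖ ^ 2 + ‖Y‖ ^ 2) ≤ condatForm t s A X Y) ∧
      ∀ p q, IsPrimalDualPair C g ψ A p q → ∀ k,
        condatForm t s A (x (k + 1) - p) (η (k + 1) - q) +
          c * (‖x k - x (k + 1)‖ ^ 2 + ‖η k - η (k + 1)‖ ^ 2 + ‖C (x k) - C p‖ ^ 2) ≤
        condatForm t s A (x k - p) (η k - q) := by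
  obtain ⟨c, hc, hform⟩ := condatForm_coercive (κ := κ) hs ht hμ hA hsb
  have hκ0 : 0 < κ := by linarith
  have hd : 0 < 2 / L - 1 / κ := by
    have : 2 / L - 1 / κ = (2 * κ - L) / (L * κ) := by field_simp
    rw [this]
    exact div_pos (by linarith) (by positivity)
  refine ⟨min c (2 / L - 1 / κ), lt_min hc hd, fun X Y => ?_, fun p q hpq k => ?_⟩
  · have h1 := hform X Y
    have h2 := mul_le_mul_of_nonneg_right (min_le_left c (2 / L - 1 / κ))
      (by positivity : 0 ≤ ‖X‖ ^ 2 + ‖Y‖ ^ 2)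
    have : 0 ≤ κ * ‖X‖ ^ 2 := by positivity
    linarith
  · have h0 := hrun.condatForm_le hg hψ hpq k
    have h1 := hform (x k - x (k + 1)) (η k - η (k + 1))
    have h2 := mul_le_mul_of_nonneg_right (min_le_left c (2 / L - 1 / κ))
      (by positivity : 0 ≤ ‖x k - x (k + 1)‖ ^ 2 + ‖η k - η (k + 1)‖ ^ 2)
    have h3 := mul_le_mul_of_nonneg_right (min_le_right c (2 / L - 1 / κ))
      (by positivity : 0 ≤ ‖C (x k) - C p‖ ^ 2)
    have h4 := hC (x k) p
    have h5 : inner ℝ (C (x k) - C p) (x (k + 1) - p) =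
        inner ℝ (C (x k) - C p) (x k - p) - inner ℝ (C (x k) - C p) (x k - x (k + 1)) := by
      rw [← inner_sub_right]; congr 1; abel
    have h6 := real_inner_le_norm (C (x k) - C p) (x k - x (k + 1))
    have h7 : 0 ≤ κ * ‖x k - x (k + 1)‖ ^ 2 - 2 * (‖C (x k) - C p‖ * ‖x k - x (k + 1)‖) +
        1 / κ * ‖C (x k) - C p‖ ^ 2 := by
      have : κ * ‖x k - x (k + 1)‖ ^ 2 - 2 * (‖C (x k) - C p‖ * ‖x k - x (k + 1)‖) +
        1 / κ * ‖C (x k) - C p‖ ^ 2 =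
          1 / κ * (κ * ‖x k - x (k + 1)‖ - ‖C (x k) - C p‖) ^ 2 := by
        field_simp; ring
      rw [this]; positivity
    have h8 : 2 / L * ‖C (x k) - C p‖ ^ 2 = 2 * (1 / L * ‖C (x k) - C p‖ ^ 2) := by ring
    linarith

/-- Weak cluster points of the iteration are primal-dual optimality pairs. -/
theorem IsCondatVuInclusion.isPrimalDualPair_of_weak_limit (hg : IsGammaZero g)
    (hψ : IsGammaZero ψ) (hL : 0 < L)
    (hC : ∀ a b, 1 / L * ‖C a - C b‖ ^ 2 ≤ inner ℝ (C a - C b) (a - b))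
    (hrun : IsCondatVuInclusion C g ψ A t s x η) {l : Filter ℕ} [NeBot l] {M : ℝ}
    (hM : ∀ k, ‖x k‖ ≤ M ∧ ‖η k‖ ≤ M) (hdx : Tendsto (fun k => x k - x (k + 1)) l (𝓝 0))
    (hdη : Tendsto (fun k => η k - η (k + 1)) l (𝓝 0)) {c : H}
    (hc : Tendsto (fun k => C (x k)) l (𝓝 c)) {x₀ : H} {η₀ : K}
    (hx : ∀ v, Tendsto (fun k => inner ℝ v (x k)) l (𝓝 (inner ℝ v x₀)))
    (hη : ∀ v, Tendsto (fun k => inner ℝ v (η k)) l (𝓝 (inner ℝ v η₀))) :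
    IsPrimalDualPair C g ψ A x₀ η₀ := by
  -- `C (x k)` converges strongly, so cocoercivity passes to the limit and reads `1 / L * ‖c - C x₀‖
  -- ^ 2 ≤ 0`.
  have hcx : C x₀ = c := by
    have h1 : Tendsto (fun k => inner ℝ (C (x k) - C x₀) (x k - x₀)) l (𝓝 0) := by
      have := (tendsto_inner_of_strong_weak (fun k => (hM k).1) (hc.sub_const (C x₀)) hx).sub
        ((hc.sub_const (C x₀)).inner (tendsto_const_nhds (x := x₀)))
      simpa [inner_sub_right] using this
    have h2 := le_of_tendsto_of_tendsto' (((hc.sub_const (C x₀)).norm.pow 2).const_mul (1 / L)) h1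
      fun k => hC (x k) x₀
    have h3 : 1 / L * ‖c - C x₀‖ ^ 2 = 0 := le_antisymm h2 (by positivity)
    have h4 : ‖c - C x₀‖ ^ 2 = 0 := (mul_eq_zero.1 h3).resolve_left (by positivity)
    exact (sub_eq_zero.1 (norm_eq_zero.1 (pow_eq_zero_iff two_ne_zero |>.1 h4))).symm
  have hx' : ∀ v, Tendsto (fun k => inner ℝ v (x (k + 1))) l (𝓝 (inner ℝ v x₀)) := fun v => by
    have := (hx v).sub ((tendsto_const_nhds (x := v)).inner hdx)
    simpa [inner_sub_right] using this
  have hη' : ∀ v, Tendsto (fun k => inner ℝ v (η (k + 1))) l (𝓝 (inner ℝ v η₀)) := fun v => by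
    have := (hη v).sub ((tendsto_const_nhds (x := v)).inner hdη)
    simpa [inner_sub_right] using this
  -- The residuals collect every strongly vanishing term; the rest is expressed at index `k + 1`.
  let E : ℕ → H := fun k =>
    (1 / t) • (x k - x (k + 1)) - (C (x k) - c) - A.adjoint (η k - η (k + 1))
  let F : ℕ → K := fun k => (1 / s) • (η k - η (k + 1)) - A (x k - x (k + 1))
  have hE : Tendsto E l (𝓝 0) := by
    have := ((hdx.const_smul (1 / t)).sub (hc.sub_const c)).sub
      ((A.adjoint.continuous.tendsto 0).comp hdη)
    simp only [map_zero, smul_zero, sub_self] at this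
    exact this
  have hF : Tendsto F l (𝓝 0) := by
    have := (hdη.const_smul (1 / s)).sub ((A.continuous.tendsto 0).comp hdx)
    simp only [map_zero, smul_zero, sub_zero] at this
    exact this
  -- The two subgradient inequalities must be added: `⟨A x, η⟩` need not pass to a weak limit, but
  -- it cancels in the sum.
  have key : ∀ (a : H) (b : K) (α β : ℝ), g a = α → ψ b = β →
      g x₀ + ψ η₀ ≤ ((α + β + inner ℝ (C x₀ + A.adjoint η₀) (a - x₀) -
        inner ℝ (A x₀) (b - η₀) : ℝ) : EReal) := by
    intro a b α β ha hb
    let m : ℕ → H := fun k => (1 / t) • (x k - x (k + 1)) - C (x k) - A.adjoint (η k)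
    let n : ℕ → K := fun k => (1 / s) • (η k - η (k + 1)) + A ((2 : ℝ) • x (k + 1) - x k)
    have hm : ∀ k, m k = E k - c - A.adjoint (η (k + 1)) := fun k => by
      simp only [m, E, map_sub]; abel
    have hn : ∀ k, n k = F k + A (x (k + 1)) := fun k => by
      simp only [n, F, map_sub, map_add, two_smul]; abel
    refine hg.add_le_of_weak_limit hψ (R := fun k => α + β - inner ℝ (m k) (a - x (k + 1)) -
      inner ℝ (n k) (b - η (k + 1))) hx' hη' ?_ fun k => ?_
    · have hR : ∀ k, α + β - inner ℝ (m k) (a - x (k + 1)) - inner ℝ (n k) (b - η (k + 1)) =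
          α + β - inner ℝ (E k) a + inner ℝ (E k) (x (k + 1)) + inner ℝ c a -
            inner ℝ c (x (k + 1)) + inner ℝ (A a) (η (k + 1)) - inner ℝ (F k) b +
            inner ℝ (F k) (η (k + 1)) - inner ℝ (A.adjoint b) (x (k + 1)) := fun k => by
        rw [hm, hn]
        simp only [inner_sub_left, inner_sub_right, inner_add_left,
          ContinuousLinearMap.adjoint_inner_left, real_inner_comm (η (k + 1)) (A a),
          real_inner_comm b (A (x (k + 1))), real_inner_comm (η (k + 1)) (A (x (k + 1)))]
        ring
      have hR₀ : α + β + inner ℝ (C x₀ + A.adjoint η₀) (a - x₀) - inner ℝ (A x₀) (b - η₀) =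
          α + β - inner ℝ 0 a + inner ℝ 0 x₀ + inner ℝ c a -
            inner ℝ c x₀ + inner ℝ (A a) η₀ - inner ℝ 0 b +
            inner ℝ 0 η₀ - inner ℝ (A.adjoint b) x₀ := by
        simp only [inner_sub_right, inner_add_left, inner_zero_left, hcx,
          ContinuousLinearMap.adjoint_inner_left, real_inner_comm η₀ (A a),
          real_inner_comm b (A x₀), real_inner_comm η₀ (A x₀)]
        ring
      rw [hR₀]
      simp only [hR]
      have hEa : Tendsto (fun k => inner ℝ (E k) a) l (𝓝 (inner ℝ 0 a)) :=
        hE.inner tendsto_const_nhds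
      have hFb : Tendsto (fun k => inner ℝ (F k) b) l (𝓝 (inner ℝ 0 b)) :=
        hF.inner tendsto_const_nhds
      have hEx := tendsto_inner_of_strong_weak (fun k => (hM (k + 1)).1) hE hx'
      have hFη := tendsto_inner_of_strong_weak (fun k => (hM (k + 1)).2) hF hη'
      exact (((((((tendsto_const_nhds.sub hEa).add hEx).add tendsto_const_nhds).sub
        (hx' c)).add (hη' (A a))).sub hFb).add hFη).sub (hx' (A.adjoint b))
    · obtain ⟨r, hr⟩ := (hrun k).1.exists_real hg
      obtain ⟨r', hr'⟩ := (hrun k).2.exists_real hψ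
      have h1 := (hrun k).1 a
      have h2 := (hrun k).2 b
      rw [hr, ha, ← EReal.coe_add, EReal.coe_le_coe_iff] at h1
      rw [hr', hb, ← EReal.coe_add, EReal.coe_le_coe_iff] at h2
      rw [hr, hr', ← EReal.coe_add, EReal.coe_le_coe_iff]
      linarith
  obtain ⟨a₁, α₁, ha₁⟩ := hg.exists_real
  obtain ⟨b₁, β₁, hb₁⟩ := hψ.exists_real
  have hfin := key a₁ b₁ α₁ β₁ ha₁ hb₁
  have hgfin : g x₀ ≠ ⊤ := fun h => by
    rw [h, EReal.top_add_of_ne_bot (hψ.ne_bot _)] at hfin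
    exact EReal.coe_ne_top _ (top_le_iff.1 hfin)
  have hψfin : ψ η₀ ≠ ⊤ := fun h => by
    rw [h, EReal.add_top_of_ne_bot (hg.ne_bot _)] at hfin
    exact EReal.coe_ne_top _ (top_le_iff.1 hfin)
  obtain ⟨r, hr⟩ := hg.eq_coe hgfin
  obtain ⟨r', hr'⟩ := hψ.eq_coe hψfin
  -- Choosing `b = η₀`, respectively `a = x₀`, decouples the joint inequality.
  constructor
  · intro z
    by_cases hz : g z = ⊤
    · rw [hz]; exact le_top
    obtain ⟨α, hα⟩ := hg.eq_coe hz
    have := key z η₀ α r' hα hr'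
    rw [hr, hr', ← EReal.coe_add, EReal.coe_le_coe_iff, sub_self, inner_zero_right] at this
    rw [hr, hα, ← EReal.coe_add, EReal.coe_le_coe_iff, ← neg_add', inner_neg_left]
    linarith
  · intro z
    by_cases hz : ψ z = ⊤
    · rw [hz]; exact le_top
    obtain ⟨β, hβ⟩ := hψ.eq_coe hz
    have := key x₀ z r β hr hβ
    rw [hr, hr', ← EReal.coe_add, EReal.coe_le_coe_iff, sub_self, inner_zero_right] at this
    rw [hr', hβ, ← EReal.coe_add, EReal.coe_le_coe_iff]
    linarith

/-- Weak convergence of the Condat–Vũ iteration. -/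
theorem IsCondatVuInclusion.exists_weak_limit (hg : IsGammaZero g) (hψ : IsGammaZero ψ)
    (hL : 0 < L) (hC : ∀ a b, 1 / L * ‖C a - C b‖ ^ 2 ≤ inner ℝ (C a - C b) (a - b))
    (hs : 0 < s) (ht : 1 / t = κ + μ) (hκ : L / 2 < κ) (hμ : 0 < μ)
    (hA : ∀ v, ‖A v‖ ≤ b * ‖v‖) (hsb : s * b ^ 2 < μ)
    (hrun : IsCondatVuInclusion C g ψ A t s x η)
    (hsol : ∃ p q, IsPrimalDualPair C g ψ A p q) :
    ∃ x₀ η₀, IsPrimalDualPair C g ψ A x₀ η₀ ∧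
      ∀ v, Tendsto (fun k => inner ℝ v (x k)) atTop (𝓝 (inner ℝ v x₀)) := by
  obtain ⟨c, hc, hform, hfejer⟩ :=
    hrun.fejer hg hψ hL hC hs ht hκ hμ hA hsb
  obtain ⟨p, q, hpq⟩ := hsol
  obtain ⟨-, ⟨M, hM⟩, hdx, hdη, hCx⟩ := asymptotics_of_fejer hc hform (hfejer p q hpq)
  have hcluster : ∀ U : Ultrafilter ℕ, (U : Filter ℕ) ≤ atTop → ∃ x₀ η₀,
      IsPrimalDualPair C g ψ A x₀ η₀ ∧
      (∀ v, Tendsto (fun k => inner ℝ v (x k)) U (𝓝 (inner ℝ v x₀))) ∧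
      ∀ v, Tendsto (fun k => inner ℝ v (η k)) U (𝓝 (inner ℝ v η₀)) := by
    intro U hU
    obtain ⟨x₀, hx₀⟩ := exists_weak_limit_of_bounded U fun k => (hM k).1
    obtain ⟨η₀, hη₀⟩ := exists_weak_limit_of_bounded U fun k => (hM k).2
    exact ⟨x₀, η₀, hrun.isPrimalDualPair_of_weak_limit hg hψ hL hC hM (hdx.mono_left hU)
      (hdη.mono_left hU) (hCx.mono_left hU) hx₀ hη₀, hx₀, hη₀⟩
  obtain ⟨x₀, η₀, hpair, hx₀, hη₀⟩ := hcluster (Ultrafilter.of atTop) (Ultrafilter.of_le _)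
  refine ⟨x₀, η₀, hpair, fun v => (tendsto_iff_ultrafilter _ _ _).2 fun U hU => ?_⟩
  obtain ⟨x₁, η₁, hpair', hx₁, hη₁⟩ := hcluster U hU
  obtain ⟨⟨ℓ, hℓ⟩, -⟩ := asymptotics_of_fejer hc hform (hfejer _ _ hpair)
  obtain ⟨⟨ℓ', hℓ'⟩, -⟩ := asymptotics_of_fejer hc hform (hfejer _ _ hpair')
  have hdiff := hℓ.sub hℓ'
  -- Opial: the quadratic parts cancel, so the difference is affine in the iterates and passes to
  -- weak limits.
  have hid : ∀ k, condatForm t s A (x k - x₀) (η k - η₀) - condatForm t s A (x k - x₁) (η k - η₁) =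
      (1 / t * (‖x₀‖ ^ 2 - ‖x₁‖ ^ 2 - 2 * inner ℝ (x₀ - x₁) (x k)) +
        1 / s * (‖η₀‖ ^ 2 - ‖η₁‖ ^ 2 - 2 * inner ℝ (η₀ - η₁) (η k))) +
        2 * (inner ℝ (A (x₀ - x₁)) (η k) + inner ℝ (A.adjoint (η₀ - η₁)) (x k) -
          inner ℝ (A x₀) η₀ + inner ℝ (A x₁) η₁) := fun k => by
    simp only [condatForm, map_sub, inner_sub_left, inner_sub_right, norm_sub_sq_real,
      ContinuousLinearMap.adjoint_inner_right, real_inner_comm (x k), real_inner_comm (η k)]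
    ring
  have hlim : ∀ (V : Ultrafilter ℕ), (V : Filter ℕ) ≤ atTop → ∀ (y : H) (ζ : K),
      (∀ v, Tendsto (fun k => inner ℝ v (x k)) V (𝓝 (inner ℝ v y))) →
      (∀ v, Tendsto (fun k => inner ℝ v (η k)) V (𝓝 (inner ℝ v ζ))) →
      ℓ - ℓ' = (1 / t * (‖x₀‖ ^ 2 - ‖x₁‖ ^ 2 - 2 * inner ℝ (x₀ - x₁) y) +
        1 / s * (‖η₀‖ ^ 2 - ‖η₁‖ ^ 2 - 2 * inner ℝ (η₀ - η₁) ζ)) +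
        2 * (inner ℝ (A (x₀ - x₁)) ζ + inner ℝ (A.adjoint (η₀ - η₁)) y -
          inner ℝ (A x₀) η₀ + inner ℝ (A x₁) η₁) := by
    intro V hV y ζ hy hζ
    refine tendsto_nhds_unique (hdiff.mono_left hV) ?_
    simp only [hid]
    exact ((((tendsto_const_nhds.sub ((hy _).const_mul 2)).const_mul _).add
      ((tendsto_const_nhds.sub ((hζ _).const_mul 2)).const_mul _))).add
      (((((hζ _).add (hy _)).sub tendsto_const_nhds).add tendsto_const_nhds).const_mul 2)
  have e₀ := hlim _ (Ultrafilter.of_le _) x₀ η₀ hx₀ hη₀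
  have e₁ := hlim U hU x₁ η₁ hx₁ hη₁
  -- Both cluster points give the same value `ℓ - ℓ'`; subtracting leaves a multiple of the form at
  -- their difference.
  have hzero : condatForm t s A (x₀ - x₁) (η₀ - η₁) = 0 := by
    have h1 : condatForm t s A (x₀ - x₁) (η₀ - η₁) =
        1 / t * (inner ℝ (x₀ - x₁) x₀ - inner ℝ (x₀ - x₁) x₁) +
        1 / s * (inner ℝ (η₀ - η₁) η₀ - inner ℝ (η₀ - η₁) η₁) -
        (inner ℝ (A (x₀ - x₁)) η₀ - inner ℝ (A (x₀ - x₁)) η₁) -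
        (inner ℝ (A.adjoint (η₀ - η₁)) x₀ - inner ℝ (A.adjoint (η₀ - η₁)) x₁) := by
      rw [← inner_sub_right, ← inner_sub_right, ← inner_sub_right, ← inner_sub_right,
        real_inner_self_eq_norm_sq, real_inner_self_eq_norm_sq,
        ContinuousLinearMap.adjoint_inner_left, real_inner_comm (A (x₀ - x₁)), condatForm]
      ring
    rw [h1]
    linarith
  have hle := hform (x₀ - x₁) (η₀ - η₁)
  rw [hzero] at hle
  have hx01 : ‖x₀ - x₁‖ ^ 2 = 0 := by
    have h1 := nonpos_of_mul_nonpos_right hle hc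
    exact le_antisymm (by linarith [sq_nonneg ‖η₀ - η₁‖]) (sq_nonneg _)
  rw [sub_eq_zero.1 (norm_eq_zero.1 (pow_eq_zero_iff two_ne_zero |>.1 hx01))]
  exact hx₁ v

end CondatVu

/-! ### The weighted product space -/

section WeightedProduct

variable {m : ℕ} {G : Fin m → Type*} [∀ i, NormedAddCommGroup (G i)]
  [∀ i, InnerProductSpace ℝ (G i)]

/-- Moving the weight to the second argument of the inner product puts `w i` inside the conjugate.
-/
theorem fenchelConj_weightedInner_sum {h : ∀ i, G i → EReal} (hh : ∀ i, IsGammaZero (h i))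
    (w : Fin m → ℝ) :
    fenchelConj (weightedInner w) (fun z : ∀ i, G i => ∑ i, h i (z i)) =
      fun z => ∑ i, fenchelConj (fun a b : G i => inner ℝ a b) (h i) (w i • z i) := by
  funext z
  simp only [fenchelConj]
  rw [← EReal.iSup_pi_sum Finset.univ
    fun i (a : G i) => ((inner ℝ a (w i • z i) : ℝ) : EReal) - h i a]
  refine iSup_congr fun y => ?_
  rw [← (EReal.coe_sum_sub_sum Finset.univ (fun i => inner ℝ (y i) (w i • z i))
    (fun i => h i (y i)) fun i => (hh i).ne_bot _).1]
  simp only [weightedInner, real_inner_smul_right]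

/-- Substituting `w i • y i` turns each summand into `(w i)⁻¹` times the coordinate prox objective
with parameter `w i * s`. -/
theorem isProx_weightedInner_sum {w : Fin m → ℝ} (hw : ∀ i, 0 < w i) {s : ℝ} (hs : 0 ≤ s)
    {φ : ∀ i, G i → EReal} {u p : ∀ i, G i}
    (h : ∀ i, IsProx (fun a b : G i => inner ℝ a b) (w i * s) (φ i) (w i • u i) (p i)) :
    IsProx (weightedInner w) s (fun y : ∀ i, G i => ∑ i, φ i (w i • y i)) u
      (fun i => (w i)⁻¹ • p i) := by
  have expand : ∀ y : ∀ i, G i,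
      ((1 / 2 * weightedInner w (y - u) (y - u) : ℝ) : EReal) +
        (s : EReal) * ∑ i, φ i (w i • y i) =
      ∑ i, (((w i)⁻¹ : ℝ) : EReal) *
        (((1 / 2 * inner ℝ (w i • y i - w i • u i) (w i • y i - w i • u i) : ℝ) : EReal) +
          ((w i * s : ℝ) : EReal) * φ i (w i • y i)) := by
    intro y
    rw [weightedInner, Finset.mul_sum, EReal.coe_finsetSum, EReal.coe_mul_finsetSum _ hs,
      ← Finset.sum_add_distrib]
    refine Finset.sum_congr rfl fun i _ => ?_
    have hwi := (hw i).ne'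
    rw [EReal.left_distrib_of_nonneg_of_ne_top (EReal.coe_nonneg.2 (inv_nonneg.2 (hw i).le))
      (EReal.coe_ne_top _), ← EReal.coe_mul,
      ← mul_assoc (((w i)⁻¹ : ℝ) : EReal), ← EReal.coe_mul, inv_mul_cancel_left₀ hwi, ← smul_sub, real_inner_smul_left, real_inner_smul_right,
      Pi.sub_apply]
    congr 2
    field_simp
  intro z
  rw [expand, expand]
  refine Finset.sum_le_sum fun i _ => mul_le_mul_of_nonneg_left ?_
    (EReal.coe_nonneg.2 (inv_nonneg.2 (hw i).le))
  rw [smul_inv_smul₀ (hw i).ne']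
  exact h i (w i • z i)

/-- The isometry from the product with the weighted scalar product onto the `ℓ²` product. -/
noncomputable def weightedEquiv (w : Fin m → ℝ) (hw : ∀ i, 0 < w i) :
    (∀ i, G i) ≃ₗ[ℝ] PiLp 2 G :=
  (LinearEquiv.piCongrRight fun i =>
    LinearEquiv.smulOfNeZero ℝ (G i) (√(w i)) (Real.sqrt_pos.2 (hw i)).ne').trans
    (WithLp.linearEquiv 2 ℝ (∀ i, G i)).symm

theorem weightedEquiv_apply (w : Fin m → ℝ) (hw : ∀ i, 0 < w i) (y : ∀ i, G i) (i : Fin m) :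
    weightedEquiv w hw y i = √(w i) • y i := rfl

theorem weightedEquiv_symm_apply (w : Fin m → ℝ) (hw : ∀ i, 0 < w i) (z : PiLp 2 G) (i : Fin m) :
    (weightedEquiv w hw).symm z i = (√(w i))⁻¹ • z i := by
  obtain ⟨y, rfl⟩ := (weightedEquiv w hw).surjective z
  rw [LinearEquiv.symm_apply_apply, weightedEquiv_apply,
    inv_smul_smul₀ (Real.sqrt_pos.2 (hw i)).ne']

theorem inner_weightedEquiv (w : Fin m → ℝ) (hw : ∀ i, 0 < w i) (y z : ∀ i, G i) :
    inner ℝ (weightedEquiv w hw y) (weightedEquiv w hw z) = weightedInner w y z := by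
  rw [PiLp.inner_apply, weightedInner]
  refine Finset.sum_congr rfl fun i _ => ?_
  rw [weightedEquiv_apply, weightedEquiv_apply, real_inner_smul_left, real_inner_smul_right,
    ← mul_assoc, Real.mul_self_sqrt (hw i).le]

end WeightedProduct

/-! ### Transport along an isometry -/

section Transfer

variable {E K : Type*} [AddCommGroup E] [Module ℝ E] [NormedAddCommGroup K]
  [InnerProductSpace ℝ K] {ip : E → E → ℝ} {T : E ≃ₗ[ℝ] K}

theorem IsProx.map_equiv (hT : ∀ a b, inner ℝ (T a) (T b) = ip a b) {lam : ℝ} {φ : E → EReal}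
    {u p : E} (h : IsProx ip lam φ u p) :
    IsProx (fun a b : K => inner ℝ a b) lam (fun z => φ (T.symm z)) (T u) (T p) := by
  intro z
  have := h (T.symm z)
  rw [← hT, ← hT, map_sub, map_sub, T.apply_symm_apply] at this
  simpa only [T.symm_apply_apply] using this

theorem fenchelConj_map_equiv (hT : ∀ a b, inner ℝ (T a) (T b) = ip a b) (φ : E → EReal) :
    (fun z => fenchelConj ip φ (T.symm z)) =
      fenchelConj (fun a b : K => inner ℝ a b) fun z => φ (T.symm z) := by
  funext z
  refine T.toEquiv.iSup_congr fun y => ?_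
  simp only [LinearEquiv.coe_toEquiv, T.symm_apply_apply]
  rw [← hT, T.apply_symm_apply]

end Transfer

/-! ### From prox steps to inclusions, and from pairs to minimizers -/

section Convergence

variable {H K : Type*} [NormedAddCommGroup H] [InnerProductSpace ℝ H] [CompleteSpace H]
  [NormedAddCommGroup K] [InnerProductSpace ℝ K] [CompleteSpace K]

theorem IsCondatVuRun.isCondatVuInclusion {E : Type*} [AddCommGroup E] [Module ℝ E]
    {ip : E → E → ℝ} {T : E ≃ₗ[ℝ] K} (hT : ∀ a b, inner ℝ (T a) (T b) = ip a b)
    {f : H → ℝ} {g : H → EReal} {Φ : E → EReal} {A₀ : H → E} {A : H →L[ℝ] K}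
    (hA : ∀ a, A a = T (A₀ a)) {t s : ℝ} (ht : 0 < t) (hs : 0 < s) {x : ℕ → H} {y : ℕ → E}
    (hg : IsGammaZero g)
    (hΦ : IsGammaZero (fenchelConj (fun a b : K => inner ℝ a b) fun z => Φ (T.symm z)))
    (hrun : IsCondatVuRun ip f g Φ A₀ t s x y) :
    IsCondatVuInclusion (fun a => ∇ f a) g
      (fenchelConj (fun a b : K => inner ℝ a b) fun z => Φ (T.symm z)) A t s x
      (fun k => T (y k)) := by
  obtain ⟨Astar, hadj, hit⟩ := hrun
  -- The adjoint in the run is given only by its defining identity, which determines it.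
  have hAstar : ∀ b, Astar b = A.adjoint (T b) := fun b => by
    refine ext_inner_left ℝ fun a => ?_
    rw [← hadj, ContinuousLinearMap.adjoint_inner_right, hA, hT]
  intro k
  obtain ⟨h1, h2⟩ := hit k
  have h1' := h1.isSubgradient hg ht
  have h2' := h2.map_equiv hT
  rw [fenchelConj_map_equiv hT] at h2'
  have h2'' := h2'.isSubgradient hΦ hs
  constructor
  · convert h1' using 1
    rw [hAstar, ← sub_eq_zero]
    simp only [smul_sub, smul_smul, one_div, inv_mul_cancel₀ ht.ne', one_smul]
    abel
  · convert h2'' using 1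
    rw [map_add, map_smul, ← hA]
    simp only [smul_sub, smul_add, smul_smul, one_div, inv_mul_cancel₀ hs.ne', one_smul]
    abel

/-- Primal-dual optimality is sufficient for minimality. -/
theorem add_le_add_of_isSubgradient {f : H → ℝ} (hc : ConvexOn ℝ Set.univ f)
    (hf : Differentiable ℝ f) {g : H → EReal} {Φ : K → EReal} (hg : IsGammaZero g)
    (hΦ : IsGammaZero Φ) {A : H →L[ℝ] K} {p : H} {q : K}
    (h1 : IsSubgradient g p (-(∇ f p) - A.adjoint q)) (h2 : IsSubgradient Φ (A p) q) (z : H) :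
    (f p : EReal) + g p + Φ (A p) ≤ (f z : EReal) + g z + Φ (A z) := by
  obtain ⟨r, hr⟩ := h1.exists_real hg
  obtain ⟨s, hs⟩ := h2.exists_real hΦ
  have h3 := hc.add_inner_gradient_le hf p z
  have h1' := h1 z
  have h2' := h2 (A z)
  rw [hr, ← EReal.coe_add] at h1'
  rw [hs, ← EReal.coe_add] at h2'
  refine le_trans ?_ (add_le_add (add_le_add (EReal.coe_le_coe_iff.2 h3) h1') h2')
  rw [hr, hs, ← EReal.coe_add, ← EReal.coe_add, ← EReal.coe_add, ← EReal.coe_add,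
    EReal.coe_le_coe_iff, inner_sub_left, inner_neg_left,
    ContinuousLinearMap.adjoint_inner_left, map_sub]
  linarith

end Convergence

/-! ### The splitting algorithm -/

section PrimalDual

variable {H : Type*} [NormedAddCommGroup H] [InnerProductSpace ℝ H] [CompleteSpace H]
  {m : ℕ} {G : Fin m → Type*} [∀ i, NormedAddCommGroup (G i)]
  [∀ i, InnerProductSpace ℝ (G i)] [∀ i, CompleteSpace (G i)]

theorem weightedInner_adjoint (B : ∀ i, H →L[ℝ] G i) (w : Fin m → ℝ) (a : H) (b : ∀ i, G i) :
    weightedInner w (fun i => B i a) b = inner ℝ a (∑ i, w i • (B i).adjoint (b i)) := by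
  rw [weightedInner, inner_sum]
  refine Finset.sum_congr rfl fun i _ => ?_
  rw [real_inner_smul_right, ContinuousLinearMap.adjoint_inner_right]

/-- With a single inner iteration, the splitting algorithm is the Condat–Vũ iteration. -/
theorem IsPrimalDualRun.isCondatVuRun {f : H → ℝ} {g : H → EReal} {h : ∀ i, G i → EReal}
    {B : ∀ i, H →L[ℝ] G i} (hh : ∀ i, IsGammaZero (h i)) {w : Fin m → ℝ}
    (hw : ∀ i, 0 < w i) {γ σ τ : ℝ} (hγ : 0 < γ) (hσ : 0 < σ) (hτ : 0 < τ)
    {u x : ℕ → H} {xbar : ℕ → ℕ → H} {y : ℕ → ℕ → ∀ i, G i}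
    (hrun : IsPrimalDualRun f g h B w γ σ τ (fun _ => 1) u x xbar y)
    (hxbar : ∀ k, xbar k 0 = x k) :
    IsCondatVuRun (weightedInner w) f g (fun z : ∀ i, G i => ∑ i, h i (z i))
        (fun a i => B i a) (τ * γ / (1 + τ)) (σ / γ) x (fun k => (1 / γ) • y k 0) := by
  refine ⟨fun b => ∑ i, w i • (B i).adjoint (b i), weightedInner_adjoint B w, fun k => ⟨?_, ?_⟩⟩
  · have h1 := hrun.inner_primal k 0 zero_lt_one
    rw [zero_add, hxbar, ← hrun.update k, hrun.outer k] at h1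
    convert h1 using 1
    have e : ∑ i, w i • (B i).adjoint (((1 / γ) • y k 0) i) =
        (1 / γ) • ∑ i, w i • (B i).adjoint (y k 0 i) := by
      rw [Finset.smul_sum]
      refine Finset.sum_congr rfl fun i _ => ?_
      rw [Pi.smul_apply, map_smul, smul_comm]
    beta_reduce
    rw [e]
    have h1τ : (1 + τ) ≠ 0 := by positivity
    match_scalars <;> field_simp
  · choose p hp hy using hrun.inner_dual k 0 zero_lt_one
    rw [fenchelConj_weightedInner_sum hh]
    -- Dividing by `γ` leaves the factor `(w i)⁻¹` of the weighted prox.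
    have e : (1 / γ) • y (k + 1) 0 = fun i => (w i)⁻¹ • p i := by
      funext i
      have := (hw i).ne'
      rw [hrun.restart_dual k, Pi.smul_apply]
      refine (congrArg _ (hy i)).trans ?_
      rw [smul_smul]
      congr 1
      field_simp
    beta_reduce
    rw [e]
    refine isProx_weightedInner_sum hw (by positivity) fun i => ?_
    convert hp i using 1
    rw [zero_add, hxbar, ← hrun.update k]
    simp only [Pi.add_apply, Pi.smul_apply, smul_add, smul_smul]
    congr 2 <;> ring

end PrimalDual

theorem theorem4p6
    {H : Type*} [NormedAddCommGroup H] [InnerProductSpace ℝ H] [CompleteSpace H]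
    {m : ℕ} {G : Fin m → Type*} [∀ i, NormedAddCommGroup (G i)]
    [∀ i, InnerProductSpace ℝ (G i)] [∀ i, CompleteSpace (G i)]
    (f : H → ℝ) (g : H → EReal) (h : ∀ i, G i → EReal) (B : ∀ i, H →L[ℝ] G i)
    (L : ℝ) (hL : 0 < L)
    (hf_convex : ConvexOn ℝ Set.univ f) (hf_diff : Differentiable ℝ f)
    (hf_lip : ∀ a b : H, ‖∇ f a - ∇ f b‖ ≤ L * ‖a - b‖)
    (hg : IsGammaZero g) (hh : ∀ i, IsGammaZero (h i))
    (hsol : OptimalityInclusionSolvable f g h B)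
    (w : Fin m → ℝ) (hw_pos : ∀ i, 0 < w i) (hw_sum : ∑ i, w i = 1)
    (γ σ τ : ℝ) (hγ : 0 < γ) (hγL : γ < 2 / L) (hσ : 0 < σ) (hτ : 0 < τ)
    (hστ : σ * τ * ∑ i, w i * ‖B i‖ ^ 2 < 1)
    (u x : ℕ → H) (xbar : ℕ → ℕ → H) (y : ℕ → ℕ → ∀ i, G i)
    (hrun : IsPrimalDualRun f g h B w γ σ τ (fun _ => 1) u x xbar y)
    (hxbar : ∀ k, xbar k 0 = x k) :
    IsCondatVuRun (weightedInner w) f g (fun z : ∀ i, G i => ∑ i, h i (z i))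
        (fun a i => B i a) (τ * γ / (1 + τ)) (σ / γ) x (fun k => (1 / γ) • y k 0) ∧
      ∃ xlim : H, IsSolution f g h B xlim ∧
        Tendsto (fun k => toWeakSpace ℝ H (x k)) atTop (𝓝 (toWeakSpace ℝ H xlim)) := by
  have hcv := hrun.isCondatVuRun hh hw_pos hγ hσ hτ hxbar
  refine ⟨hcv, ?_⟩
  let T := weightedEquiv (G := G) w hw_pos
  have hT : ∀ a b, inner ℝ (T a) (T b) = weightedInner w a b := inner_weightedEquiv w hw_pos
  let A : H →L[ℝ] PiLp 2 G := ((PiLp.continuousLinearEquiv 2 ℝ G).symm : (∀ i, G i) →L[ℝ] _).comp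
    (ContinuousLinearMap.pi fun i => √(w i) • B i)
  have hA : ∀ a, A a = T (fun i => B i a) := fun a => rfl
  let Φ : PiLp 2 G → EReal := fun z => ∑ i, h i (T.symm z i)
  have hΦA : ∀ a, Φ (A a) = ∑ i, h i (B i a) := fun a => by
    simp only [Φ, hA, T.symm_apply_apply]
  have hadj : ∀ b, A.adjoint (T b) = ∑ i, w i • (B i).adjoint (b i) := fun b => by
    refine ext_inner_left ℝ fun a => ?_
    rw [← weightedInner_adjoint, ContinuousLinearMap.adjoint_inner_right, hA, hT]
  obtain ⟨p, v, hv, hp⟩ := hsol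
  have hΦ : IsGammaZero Φ := by
    have hfin : ∃ z : PiLp 2 G, ∀ i, h i (((√(w i))⁻¹ • PiLp.proj (𝕜 := ℝ) 2 G i) z) ≠ ⊤ := by
      refine ⟨A p, fun i => ?_⟩
      obtain ⟨r, hr⟩ := (hv i).exists_real (hh i)
      have e : ((√(w i))⁻¹ • PiLp.proj (𝕜 := ℝ) 2 G i) (A p) = B i p :=
        inv_smul_smul₀ (Real.sqrt_pos.2 (hw_pos i)).ne' _
      rw [e, hr]
      exact EReal.coe_ne_top _
    have := isGammaZero_sum_comp hh _ hfin
    convert this using 5 with z i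
    exact weightedEquiv_symm_apply w hw_pos z i
  -- The multipliers are divided by `w i` because the weighted product multiplies by it.
  have hq : IsSubgradient Φ (A p) (T fun i => (w i)⁻¹ • v i) := by
    intro z
    obtain ⟨y', rfl⟩ := T.surjective z
    rw [hΦA, hA, ← map_sub, hT, weightedInner, EReal.coe_finsetSum, ← Finset.sum_add_distrib]
    simp only [Φ, T.symm_apply_apply]
    refine Finset.sum_le_sum fun i _ => ?_
    rw [real_inner_smul_left, mul_inv_cancel_left₀ (hw_pos i).ne']
    exact hv i (y' i)
  have hfin : ∃ q, fenchelConj (fun a b : PiLp 2 G => inner ℝ a b) Φ q ≠ ⊤ := by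
    obtain ⟨r, hr⟩ := hq.exists_real hΦ
    exact ⟨_, by rw [hq.fenchelConj_eq hΦ.ne_bot hr]; exact EReal.coe_ne_top _⟩
  have hψ := hΦ.fenchelConj hfin
  have ht0 : 0 < τ * γ / (1 + τ) := by positivity
  have hs0 : 0 < σ / γ := by positivity
  have hincl := hcv.isCondatVuInclusion hT hA ht0 hs0 hg hψ
  have hpair : IsPrimalDualPair (fun a => ∇ f a) g
      (fenchelConj (fun a b : PiLp 2 G => inner ℝ a b) Φ) A p (T fun i => (w i)⁻¹ • v i) := by
    refine ⟨?_, hq.fenchelConj hΦ⟩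
    rw [hadj]
    convert hp using 3 with i
    rw [map_smul, smul_inv_smul₀ (hw_pos _).ne']
  have hsum0 : 0 ≤ ∑ i, w i * ‖B i‖ ^ 2 :=
    Finset.sum_nonneg fun i _ => mul_nonneg (hw_pos i).le (sq_nonneg _)
  have hbound : ∀ a, ‖A a‖ ≤ √(∑ i, w i * ‖B i‖ ^ 2) * ‖a‖ := fun a => by
    rw [← Real.sqrt_sq (norm_nonneg a), ← Real.sqrt_mul hsum0]
    refine Real.le_sqrt_of_sq_le ?_
    rw [PiLp.norm_sq_eq_of_L2, Finset.sum_mul]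
    refine Finset.sum_le_sum fun i _ => ?_
    have e : A a i = √(w i) • B i a := rfl
    rw [e, norm_smul, mul_pow, Real.norm_eq_abs, sq_abs, Real.sq_sqrt (hw_pos i).le, mul_assoc,
      ← mul_pow]
    exact mul_le_mul_of_nonneg_left
      (pow_le_pow_left₀ (norm_nonneg _) ((B i).le_opNorm a) 2) (hw_pos i).le
  -- With these `κ` and `μ`, the conditions `L / 2 < κ` and `s * b ^ 2 < μ` are exactly `hγL` and
  -- `hστ`.
  obtain ⟨x₀, η₀, ⟨h1, h2⟩, hlim⟩ := hincl.exists_weak_limit (κ := 1 / γ) (μ := 1 / (τ * γ)) hg hψ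
    hL (fun a b => hf_convex.gradient_cocoercive hf_diff hL hf_lip a b) hs0
    (by field_simp; ring)
    (by rw [lt_div_iff₀ hL] at hγL; rw [div_lt_div_iff₀ two_pos hγ]; linarith)
    (by positivity) hbound
    (by
      rw [Real.sq_sqrt hsum0, div_mul_eq_mul_div, div_lt_div_iff₀ hγ (by positivity)]
      nlinarith)
    ⟨_, _, hpair⟩
  refine ⟨x₀, fun z _ => ?_, tendsto_toWeakSpace_of_inner hlim⟩
  have := add_le_add_of_isSubgradient hf_convex hf_diff hg hΦ h1 (h2.of_fenchelConj hΦ hfin) z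
  rwa [hΦA, hΦA] at this
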